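/- **Setting.** Pauli operators on a finite set $Q$ of qubits are taken modulo phases, as vectors $[x|z]\in\mathbb F_2^{Q}\times\mathbb F_2^{Q}$. A stabilizer code is given by a finite family $S$ of commuting checks; it is $(\alpha,\beta)$-LDPC if every check acts on at most $\alpha$ qubits and every qubit is acted on by at most $\beta$ checks. Its nontrivial logical operators are the Paulis that commute with all checks but are not products of checks; its distance is the minimum weight of such an operator ($\infty$ if there is none). *Auxiliary graphs.* Let $\overline Z=Z(\mathcal L)$ be a $Z$-type logical operator. An auxiliary graph to measure $\overline Z$ consists of a finite simple graph $\mathcal G=(\mathcal V,\mathcal E)$; pairwise disjoint sets $f(q)\subseteq\mathcal V$, $q\in Q$ (the set-valued port function), with $|f(q)|$ odd exactly for $q\in\mathcal L$; for every check $s$ with $X$-type support $\mathcal L_s$ a perfect matching $\mu(s)\subseteq\mathcal E$ of the vertices $f(\mathcal L_s)=\bigcup_{q\in\mathcal L_s}f(q)$, i.e. the edges of pairwise edge-disjoint paths that join these vertices in pairs; and a finite set of cycles (elements of the cycle space) that spans the cycle space of $\mathcal G$ over $\mathbb F_2$ (a cycle basis). The deformed code has an additional qubit for every edge and the following checks: every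 $s\in S$ multiplied by $\prod_{e\in\mu(s)}X(e)$; for every vertex $v$ the check $A_v=\prod_{e\ni v}Z(e)$, multiplied by $Z(q)$ if $v\in f(q)$; for every basis cycle $c$ the check $\prod_{e\in c}X(e)$. *Graph desiderata*, for a number $d$ and a list $K$ of constants: (0) $\mathcal G$ is connected; (1) all vertex degrees and all $|f(q)|$ are bounded by constants; (2) all $|\mu(s)|$, and for every edge the number of $s$ with $e\in\mu(s)$, are bounded by constants; (3) the lengths of the basis cycles, and for every edge the number of basis cycles that contain it, are bounded by constants; (4) $\beta_d(\mathcal G,\operatorname{im}f)\ge1$, i.e. with $\mathcal U=\bigcup_q f(q)$, every set $W\subseteq\mathcal V$ has at least $\min(d,|W\cap\mathcal U|,|\mathcal U\setminus W|)$ edges leaving it. **Theorem.** For all $\alpha,\beta,c$ and every list $K$ of constants there are $\alpha',\beta'$ and a list $K'$ of constants, depending only on these, such that the following holds for every $(\alpha,\beta)$-LDPC stabilizer code, $d$ being its distance, and every $t\ge1$. Let $\overline Z_0,\dots,\overline Z_{t-1}$ be nontrivial logical operators such that every qubit is in the support of at most $c$ of them, and suppose that some choice of single-qubit Cliffords makes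 them all $Z$-type; apply these Cliffords to the code and the operators. For every $i$ let an auxiliary graph $\mathcal G_i=(\mathcal V_i,\mathcal E_i)$ to measure $\overline Z_i$, with port function $f_i$ and matchings $\mu_i$, be given that satisfies the graph desiderata with $d$ and $K$, and suppose that for every qubit $q$ at most $c$ of the sets $f_i(q)$ are nonempty (this is automatic if qubits outside the support of $\overline Z_i$ are not attached to $\mathcal G_i$). Then there is an auxiliary graph $\mathcal G$ to measure the product $\overline Z=\overline Z_0\cdots\overline Z_{t-1}$, with vertex set $\bigsqcup_i\mathcal V_i$, port function $f(q)=\bigsqcup_i f_i(q)$, matchings $\mu(s)=\bigsqcup_i\mu_i(s)$ and a suitable cycle basis, such that: 1. $\mathcal G$ is obtained by chaining the $\mathcal G_i$ with SkipTree-based adapters: $\mathcal G_i$ is first extended to a graph $\mathcal G_i'$ on $\mathcal V_i$ by adding (possibly no) edges between vertices of $f_i(\mathcal L_s)$ for checks $s$; for some $a\ge d$ there are distinct port vertices $\ell_i(0),\dots,\ell_i(a-1)$ of $\mathcal G_i'$ and a matrix $T_i\in\mathbb F_2^{a\times m_i}$ with at most 3 ones in each row and 2 in each column such that $T_i$ times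 the incidence matrix of the subgraph induced by these vertices (which has $m_i$ edges), with columns ordered by $\ell_i$, is the cyclic check matrix $H_C$ of the repetition code of length $a$ (row $k$ is $e_k+e_{k+1 \bmod a}$); and the edges of $\mathcal G$ are those of all $\mathcal G'_i$ and the edges joining $\ell_i(k)$ to $\ell_{i+1}(k)$ for $0\le i<t-1$, $0\le k<a$. 2. $\mathcal G$ satisfies all graph desiderata for $\overline Z$ with $d$ and $K'$. 3. The checks of the deformed code commute, and the product of all vertex checks is $\overline Z$. If $\overline Z$ is a nontrivial logical operator, the deformed code has exactly one logical qubit less than the original code. 4. The deformed code is $(\alpha',\beta')$-LDPC (so check weights and qubit degrees are independent of $t$) and has distance at least $d$. -/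

import Mathlib

universe u v w

noncomputable section

/-! ### Pauli operators, check families and stabilizer codes -/

/-- Pauli operators on a set `Q` of qubits modulo phases, as symplectic vectors `[x | z]`:
`P.1` is the `X`-part and `P.2` the `Z`-part.  Multiplication of Paulis is addition of vectors. -/
abbrev Pauli (Q : Type*) := (Q → ZMod 2) × (Q → ZMod 2)

namespace Pauli

variable {Q : Type*} [Fintype Q]

/-- The symplectic form: it vanishes iff the two Pauli operators commute. -/
def symp (P R : Pauli Q) : ZMod 2 := ∑ q, (P.1 q * R.2 q + P.2 q * R.1 q)

open Classical in
/-- The set of qubits on which a Pauli operator acts nontrivially. -/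
def support (P : Pauli Q) : Finset Q := Finset.univ.filter fun q => P.1 q ≠ 0 ∨ P.2 q ≠ 0

open Classical in
/-- The `X`-type support: the qubits on which the operator acts as `X` or `Y`. -/
def xSupport (P : Pauli Q) : Finset Q := Finset.univ.filter fun q => P.1 q ≠ 0

/-- The Pauli weight. -/
def weight (P : Pauli Q) : ℕ := P.support.card

/-- `Z`-type operators: no `X`-part. -/
def IsZType (P : Pauli Q) : Prop := P.1 = 0

end Pauli

/-- A single-qubit Clifford on every qubit.  Modulo Paulis and phases the single-qubit Clifford
group is `Sp(2, 𝔽₂) = SL(2, 𝔽₂)`, acting on the column `(x, z)`. -/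
abbrev LocalClifford (Q : Type*) := Q → Matrix.SpecialLinearGroup (Fin 2) (ZMod 2)

/-- Conjugation of a Pauli operator by a product of single-qubit Cliffords. -/
def LocalClifford.act {Q : Type*} (U : LocalClifford Q) (P : Pauli Q) : Pauli Q :=
  (fun q => (U q).1 0 0 * P.1 q + (U q).1 0 1 * P.2 q,
   fun q => (U q).1 1 0 * P.1 q + (U q).1 1 1 * P.2 q)

section Code

variable {Q S : Type*} [Fintype Q] [Fintype S]

/-- All checks commute, i.e. the family of checks defines a stabilizer code. -/
def ChecksCommute (check : S → Pauli Q) : Prop :=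
  ∀ s s', (check s).symp (check s') = 0

/-- The stabilizer group (modulo phases): all products of checks. -/
def stabilizerGroup (check : S → Pauli Q) : Submodule (ZMod 2) (Pauli Q) :=
  Submodule.span (ZMod 2) (Set.range check)

/-- Logical operators commute with all checks. -/
def IsLogical (check : S → Pauli Q) (P : Pauli Q) : Prop :=
  ∀ s, (check s).symp P = 0

/-- A nontrivial logical operator is not a product of checks. -/
def IsNontrivialLogical (check : S → Pauli Q) (P : Pauli Q) : Prop :=
  IsLogical check P ∧ P ∉ stabilizerGroup check

/-- The code distance: the least weight of a nontrivial logical operator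
(`⊤` if there is none, i.e. if the code has no logical qubits). -/
def codeDistance (check : S → Pauli Q) : ℕ∞ :=
  ⨅ (P : Pauli Q) (_ : IsNontrivialLogical check P), (P.weight : ℕ∞)

/-- The number of logical qubits: number of qubits minus the rank of the stabilizer group. -/
def numLogical (check : S → Pauli Q) : ℤ :=
  (Fintype.card Q : ℤ) - (Module.finrank (ZMod 2) (stabilizerGroup check) : ℤ)

open Classical in
/-- `(α, β)`-LDPC: every check acts on at most `α` qubits and every qubit is acted on by at most
`β` checks. -/
def IsLDPC (check : S → Pauli Q) (α β : ℕ) : Prop :=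
  (∀ s, (check s).weight ≤ α) ∧
  ∀ q, (Finset.univ.filter fun s => q ∈ (check s).support).card ≤ β

end Code

open Classical in
/-- A finite family of Pauli operators is `c`-disjoint if every qubit is in the support of at most
`c` of them. -/
def IsCDisjoint {Q ι : Type*} [Fintype Q] [Fintype ι] (c : ℕ) (P : ι → Pauli Q) : Prop :=
  ∀ q, (Finset.univ.filter fun i => q ∈ (P i).support).card ≤ c

/-! ### Graphs -/

section Graph

variable {V : Type*}

/-- The type of edges of a graph. -/
abbrev GraphEdge (G : SimpleGraph V) := {e : Sym2 V // e ∈ G.edgeSet}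

instance GraphEdge.instFintype [Fintype V] (G : SimpleGraph V) : Fintype (GraphEdge G) :=
  Fintype.ofFinite _

open Classical in
/-- The incidence matrix over `𝔽₂`, rows indexed by edges and columns by vertices. -/
def incidence (G : SimpleGraph V) : Matrix (GraphEdge G) V (ZMod 2) :=
  Matrix.of fun e x => if x ∈ e.1 then 1 else 0

open Classical in
/-- The indicator vector of a set of edges. -/
def edgeVec (G : SimpleGraph V) (c : Finset (Sym2 V)) : GraphEdge G → ZMod 2 :=
  fun e => if e.1 ∈ c then 1 else 0

open Classical in
/-- `β_t(G, U) ≥ r` : for every `x ∈ 𝔽₂^V` with restriction `y` to `U`,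
`|x Gᵀ| ≥ r * min (t, |y|, |U| - |y|)`. -/
def RelExpansionGE [Fintype V] (G : SimpleGraph V) (t : ℕ) (U : Finset V) (r : ℝ) : Prop :=
  ∀ x : V → ZMod 2,
    r * (min t (min (U.filter fun y => x y ≠ 0).card (U.filter fun y => x y = 0).card) : ℕ) ≤
      ((Finset.univ.filter fun e => (Matrix.mulVec (incidence G) x) e ≠ 0).card : ℝ)

/-- `μ` is (the edge set of) a perfect matching of the vertices `T` in `G`: the vertices in `T` are
paired up, the two vertices of each pair are joined by a path in `G`, the paths are pairwise
edge-disjoint, and `μ` consists of all edges of these paths. -/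
def IsPathMatching (G : SimpleGraph V) (T : Finset V) (μ : Finset (Sym2 V)) : Prop :=
  ∃ (k : ℕ) (a b : Fin k → V) (p : ∀ j, G.Walk (a j) (b j)),
    (∀ j, (p j).IsPath) ∧
    Function.Injective (Sum.elim a b) ∧
    (∀ x, x ∈ T ↔ ∃ j, a j = x ∨ b j = x) ∧
    (∀ j j', j ≠ j' → ∀ e, e ∈ (p j).edges → e ∉ (p j').edges) ∧
    (∀ e, e ∈ μ ↔ ∃ j, e ∈ (p j).edges)

/-- `C` is a complete cycle basis of `G` (a set of cycles spanning the cycle space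
`{c | c G = 0}`; as for matrices `N` with `N G = 0` of full rank, redundant cycles are allowed). -/
def IsCycleBasis [Fintype V] (G : SimpleGraph V) (C : Finset (Finset (Sym2 V))) : Prop :=
  (∀ c ∈ C, ∀ e ∈ c, e ∈ G.edgeSet) ∧
  Submodule.span (ZMod 2) (edgeVec G '' (C : Set (Finset (Sym2 V)))) =
    LinearMap.ker (Matrix.vecMulLinear (incidence G))

open Classical in
/-- The vertices `ℓ 0, …, ℓ (a-1)` are distinct and are labelled as by the SkipTree basis
transformation of the subgraph induced on them: there is a `(3, 2)`-sparse matrix `T` on the edges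
of that subgraph (row `k` is the edge set `T k`) that transforms the incidence matrix, with columns
ordered by `ℓ`, into the cyclic check matrix of the repetition code
(row `k` has its ones at `ℓ k` and `ℓ (k+1 mod a)`). -/
def IsSkipTreeOrder (G : SimpleGraph V) {a : ℕ} (ℓ : Fin a → V) : Prop :=
  Function.Injective ℓ ∧
  ∃ T : Fin a → Finset (Sym2 V),
    (∀ k, ∀ e ∈ T k, e ∈ G.edgeSet ∧ ∀ x ∈ e, x ∈ Set.range ℓ) ∧
    (∀ k, (T k).card ≤ 3) ∧
    (∀ e, (Finset.univ.filter fun k => e ∈ T k).card ≤ 2) ∧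
    ∀ k x, (((T k).filter fun e => x ∈ e).card : ZMod 2) =
      (if x = ℓ k then 1 else 0) + (if x = ℓ (finRotate a k) then 1 else 0)

end Graph

/-! ### Auxiliary graphs and deformed codes -/

/-- The data of auxiliary graph surgery on a code with qubits `Q` and checks `S`: the graph, the
set-valued port function, the matching `μ` of every check, and the cycle basis. -/
structure AuxGraph (Q S V : Type*) where
  /-- the auxiliary graph; every edge carries one additional qubit -/
  graph : SimpleGraph V
  /-- the vertices to which a qubit is attached -/
  port : Q → Finset V
  /-- the edges added to a check -/
  matching : S → Finset (Sym2 V)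
  /-- the cycles that are measured -/
  cycles : Finset (Finset (Sym2 V))

/-- The constants hidden in the `O(1)`'s of the graph desiderata. -/
structure DesiderataBounds where
  /-- vertex degree -/
  degree : ℕ
  /-- number of vertices attached to one qubit -/
  portSize : ℕ
  /-- number of edges in one matching -/
  matchSize : ℕ
  /-- number of matchings that contain one edge -/
  matchOverlap : ℕ
  /-- length of one basis cycle -/
  cycleLength : ℕ
  /-- number of basis cycles that contain one edge -/
  cycleOverlap : ℕ

namespace AuxGraph

variable {Q S V : Type*} [Fintype Q]

open Classical in
/-- The vertices attached to a set of qubits. -/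
def portOf (A : AuxGraph Q S V) (R : Finset Q) : Finset V := R.biUnion A.port

/-- The type of qubits of the deformed code. -/
abbrev Qubit (A : AuxGraph Q S V) := Q ⊕ GraphEdge A.graph

/-- The type of checks of the deformed code: the deformed original checks, the vertex checks and
the cycle checks. -/
abbrev Check (A : AuxGraph Q S V) := S ⊕ V ⊕ {c // c ∈ A.cycles}

/-- An original check `s` together with `X` on all edges of its matching. -/
def deformedOriginalCheck (A : AuxGraph Q S V) (check : S → Pauli Q) (s : S) : Pauli A.Qubit :=
  (Sum.elim (check s).1 (edgeVec A.graph (A.matching s)), Sum.elim (check s).2 0)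

open Classical in
/-- The vertex check at `x`: `Z` on all edges at `x` and on the qubit attached to `x`, if any. -/
def vertexCheck (A : AuxGraph Q S V) (x : V) : Pauli A.Qubit :=
  (0, Sum.elim (fun q => if x ∈ A.port q then 1 else 0) (fun e => incidence A.graph e x))

/-- The cycle check of `c`: `X` on all edges of `c`. -/
def cycleCheck (A : AuxGraph Q S V) (c : Finset (Sym2 V)) : Pauli A.Qubit :=
  (Sum.elim 0 (edgeVec A.graph c), 0)

/-- All checks of the deformed code. -/
def deformed (A : AuxGraph Q S V) (check : S → Pauli Q) : A.Check → Pauli A.Qubit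
  | .inl s => A.deformedOriginalCheck check s
  | .inr (.inl x) => A.vertexCheck x
  | .inr (.inr c) => A.cycleCheck c.1

/-- An operator on the original qubits, as an operator on the qubits of the deformed code. -/
def extend (A : AuxGraph Q S V) (P : Pauli Q) : Pauli A.Qubit :=
  (Sum.elim P.1 0, Sum.elim P.2 0)

open Classical in
/-- The auxiliary graph is set up to measure the `Z`-type operator with support `L` on the code with
the given checks, and it satisfies all graph desiderata with the constants `K` and for the
distance `d`. -/
structure SatisfiesDesiderata [Fintype S] [Fintype V] (A : AuxGraph Q S V)
    (check : S → Pauli Q) (L : Finset Q) (d : ℕ) (K : DesiderataBounds) : Prop where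
  /-- every vertex is attached to at most one qubit -/
  port_disjoint : ∀ q q', q ≠ q' → Disjoint (A.port q) (A.port q')
  /-- exactly the qubits of `L` are attached to an odd number of vertices -/
  port_parity : ∀ q, Odd (A.port q).card ↔ q ∈ L
  /-- `matching s` is a perfect matching of the vertices attached to the `X`-support of `s` -/
  isPathMatching : ∀ s, IsPathMatching A.graph (A.portOf (check s).xSupport) (A.matching s)
  isCycleBasis : IsCycleBasis A.graph A.cycles
  /-- the graph is connected -/
  connected : A.graph.Connected
  /-- bounded vertex degree -/
  degree_le : ∀ x, (Finset.univ.filter fun y => A.graph.Adj x y).card ≤ K.degree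
  /-- every qubit is attached to boundedly many vertices -/
  port_le : ∀ q, (A.port q).card ≤ K.portSize
  /-- every check has a short matching -/
  matchSize_le : ∀ s, (A.matching s).card ≤ K.matchSize
  /-- every edge is in few matchings -/
  matchOverlap_le : ∀ e, (Finset.univ.filter fun s => e ∈ A.matching s).card ≤ K.matchOverlap
  /-- the basis cycles are short -/
  cycleLength_le : ∀ c ∈ A.cycles, c.card ≤ K.cycleLength
  /-- every edge is in few basis cycles -/
  cycleOverlap_le : ∀ e, (A.cycles.filter fun c => e ∈ c).card ≤ K.cycleOverlap
  /-- sufficient expansion relative to the port -/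
  expansion : RelExpansionGE A.graph d (A.portOf Finset.univ) 1

section Joint

variable {t : ℕ} {V : Fin t → Type*}

open Classical in
/-- Auxiliary graph data on the disjoint union of the vertex sets of `t` auxiliary graphs: the
graph `G` and cycles `C` are arbitrary; the port function is the union of the given port functions
and the matching of a check is the union of the given matchings. -/
def joint (A : ∀ i, AuxGraph Q S (V i)) (G : SimpleGraph (Σ i, V i))
    (C : Finset (Finset (Sym2 (Σ i, V i)))) : AuxGraph Q S (Σ i, V i) where
  graph := G
  port q := Finset.univ.sigma fun i => (A i).port q
  matching s := Finset.univ.biUnion fun i => ((A i).matching s).image (Sym2.map (Sigma.mk i))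
  cycles := C

/-- `G` arises from the auxiliary graphs `A 0, …, A (t-1)` by chaining them with SkipTree-based
adapters of size at least `d`.  First, edges may be added to each of the graphs, but only between
vertices attached to the `X`-support of a common check.  Then in the `i`-th graph (with added edges)
`a ≥ d` port vertices `ℓ i 0, …, ℓ i (a-1)`, in SkipTree order, are picked, and the adapter between
graphs `i` and `i+1` consists of the `a` edges that join `ℓ i k` to `ℓ (i+1) k`. -/
def IsAdaptedChain (A : ∀ i, AuxGraph Q S (V i)) (check : S → Pauli Q) (d : ℕ)
    (G : SimpleGraph (Σ i, V i)) : Prop :=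
  (∀ i, (A i).graph ≤ G.comap (Sigma.mk i)) ∧
  (∀ i x y, G.Adj ⟨i, x⟩ ⟨i, y⟩ → (A i).graph.Adj x y ∨
    ∃ s, x ∈ (A i).portOf (check s).xSupport ∧ y ∈ (A i).portOf (check s).xSupport) ∧
  ∃ (a : ℕ) (ℓ : ∀ i, Fin a → V i), d ≤ a ∧
    (∀ i k, ℓ i k ∈ (A i).portOf Finset.univ) ∧
    (∀ i, IsSkipTreeOrder (G.comap (Sigma.mk i)) (ℓ i)) ∧
    ∀ i j, i ≠ j → ∀ x y, G.Adj ⟨i, x⟩ ⟨j, y⟩ ↔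
      ((i : ℕ) + 1 = j ∨ (j : ℕ) + 1 = i) ∧ ∃ k, ℓ i k = x ∧ ℓ j k = y

end Joint

end AuxGraph

end

/-! The proof separates what every auxiliary graph with the desiderata achieves from the
verification that the chain has them with constants independent of `t`.

Given the desiderata, linear algebra over 𝔽₂ suffices. The boundary of a matching is the port of the
X-support of its check, which makes the deformed checks commute. The cycle checks span the cycle
space, so by duality (`IsCycleBasis.exists_mulVec`) the Z-part of a logical operator on the edges is
the coboundary of a vertex set W. Multiplication by the vertex checks in W removes it and leaves a
nontrivial logical operator of the original code (`isNontrivialLogical_restrict`). W and its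
complement have the same coboundary, so the cleaning costs at most the smaller number of port
vertices on the two sides of the cut. By expansion the cut has at least that many edges, or at least
`d`; hence the distance bound. The number of logical qubits is a rank count along the same lines.

An adapter needs `d` port vertices on a tree that can be traversed in short hops. The edges added
for this join the matched pairs of vertices. A component of the graph of these pairs meets the port
of every check in an even number of vertices, so it defines a Z-type logical operator. The product
over all components is the measured operator, so some component gives a nontrivial one and has at
least `d` port vertices (`exists_large_component`). Any tree in it has a SkipTree order
(`HasSkipTour.join`), and each added edge closes a short cycle with its matching path.

In the chain, consecutive adapter edges and the hops between their ends form short cycles. Together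
with the old cycles they span: potentials on the pieces fit together after shifts by constants along
the row (`chainCycles_isCycleBasis`). Expansion is inherited because a cut that separates most of
the port of one piece from most of the port of the next must cut the adapter between them or pay
inside the pieces (`chainGraph_relExpansionGE`). Since a qubit meets at most `c` pieces, port and
matching sizes stay bounded. -/

noncomputable section

/-! ### Local Clifford invariance -/

namespace LocalClifford

variable {Q : Type*} (U : LocalClifford Q)

theorem det_eq_one (q : Q) :
    (U q).1 0 0 * (U q).1 1 1 - (U q).1 0 1 * (U q).1 1 0 = 1 := by
  have h := (U q).2
  rwa [Matrix.det_fin_two] at h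

/-- Conjugation by a product of single-qubit Cliffords as a linear equivalence. -/
def actEquiv : Pauli Q ≃ₗ[ZMod 2] Pauli Q where
  toFun := U.act
  invFun P := (fun q => (U q).1 1 1 * P.1 q - (U q).1 0 1 * P.2 q,
    fun q => (U q).1 0 0 * P.2 q - (U q).1 1 0 * P.1 q)
  map_add' P R := by
    ext q <;> simp only [act, Prod.fst_add, Prod.snd_add, Pi.add_apply] <;> ring
  map_smul' r P := by
    ext q <;> simp only [act, Prod.smul_fst, Prod.smul_snd, Pi.smul_apply, smul_eq_mul,
      RingHom.id_apply] <;> ring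
  left_inv P := by
    ext q <;> simp only [act]
    · linear_combination P.1 q * U.det_eq_one q
    · linear_combination P.2 q * U.det_eq_one q
  right_inv P := by
    ext q <;> simp only [act]
    · linear_combination P.1 q * U.det_eq_one q
    · linear_combination P.2 q * U.det_eq_one q

@[simp] theorem actEquiv_apply (P : Pauli Q) : U.actEquiv P = U.act P := rfl

theorem act_sum {ι : Type*} (s : Finset ι) (P : ι → Pauli Q) :
    U.act (∑ i ∈ s, P i) = ∑ i ∈ s, U.act (P i) := map_sum U.actEquiv P s

theorem stabilizerGroup_act {S : Type*} (check : S → Pauli Q) :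
    stabilizerGroup (fun s => U.act (check s)) =
      (stabilizerGroup check).map (U.actEquiv : Pauli Q →ₗ[ZMod 2] Pauli Q) := by
  rw [stabilizerGroup, stabilizerGroup, Submodule.map_span, ← Set.range_comp]
  rfl

variable [Fintype Q]

/-- In characteristic 2 the form on one qubit is a 2×2 determinant, which is multiplied by the
determinant 1 of the Clifford. -/
theorem symp_act (P R : Pauli Q) : (U.act P).symp (U.act R) = P.symp R := by
  refine Finset.sum_congr rfl fun q _ => ?_
  have h := U.det_eq_one q
  have h2 : (2 : ZMod 2) = 0 := rfl
  simp only [act]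
  linear_combination (P.1 q * R.2 q + P.2 q * R.1 q) * h +
    ((U q).1 0 0 * (U q).1 1 0 * P.1 q * R.1 q + (U q).1 0 1 * (U q).1 1 1 * P.2 q * R.2 q
      + (U q).1 0 1 * (U q).1 1 0 * (P.1 q * R.2 q + P.2 q * R.1 q)) * h2

theorem support_act (P : Pauli Q) : (U.act P).support = P.support := by
  ext q
  simp only [Pauli.support, Finset.mem_filter, Finset.mem_univ, true_and]
  have h := U.det_eq_one q
  rw [← not_iff_not]
  simp only [not_or, not_not, act]
  constructor
  · rintro ⟨h1, h2⟩
    constructor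
    · linear_combination (U q).1 1 1 * h1 - (U q).1 0 1 * h2 - P.1 q * h
    · linear_combination (U q).1 0 0 * h2 - (U q).1 1 0 * h1 - P.2 q * h
  · rintro ⟨h1, h2⟩
    simp [h1, h2]

theorem checksCommute_act {S : Type*} {check : S → Pauli Q} (h : ChecksCommute check) :
    ChecksCommute fun s => U.act (check s) := fun s s' => by
  simpa only [symp_act] using h s s'

theorem isLDPC_act {S : Type*} [Fintype S] {check : S → Pauli Q} {α β : ℕ} (h : IsLDPC check α β) :
    IsLDPC (fun s => U.act (check s)) α β := by
  refine ⟨fun s => by simpa only [Pauli.weight, support_act] using h.1 s, fun q => ?_⟩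
  convert h.2 q using 4
  rw [support_act]

theorem isNontrivialLogical_act {S : Type*} (check : S → Pauli Q) (P : Pauli Q) :
    IsNontrivialLogical (fun s => U.act (check s)) (U.act P) ↔ IsNontrivialLogical check P := by
  simp only [IsNontrivialLogical, IsLogical, symp_act, stabilizerGroup_act]
  rw [← actEquiv_apply, Submodule.mem_map_equiv, LinearEquiv.symm_apply_apply]

theorem codeDistance_act {S : Type*} (check : S → Pauli Q) :
    codeDistance (fun s => U.act (check s)) = codeDistance check := by
  unfold codeDistance
  rw [← U.actEquiv.toEquiv.iInf_comp]
  refine iInf_congr fun P => ?_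
  simp [isNontrivialLogical_act, Pauli.weight, support_act]

theorem numLogical_act {S : Type*} (check : S → Pauli Q) :
    numLogical (fun s => U.act (check s)) = numLogical check := by
  unfold numLogical
  rw [stabilizerGroup_act, LinearEquiv.finrank_map_eq]

end LocalClifford
end

noncomputable section

/-! ### Coboundaries and a dual description of cycle bases -/

section CycleSpace

variable {V : Type*} [Fintype V]

open Classical in
/-- The sum of a vertex potential over the vertices of an edge. -/
def coboundary (w : V → ZMod 2) (e : Sym2 V) : ZMod 2 := ∑ x, if x ∈ e then w x else 0

theorem coboundary_mk (w : V → ZMod 2) {a b : V} (h : a ≠ b) :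
    coboundary w s(a, b) = w a + w b := by
  classical
  have : ∀ x, (if x ∈ s(a, b) then w x else 0) =
      (if x = a then w x else 0) + (if x = b then w x else 0) := by
    intro x
    by_cases h1 : x = a
    · subst h1; simp [h]
    · simp [h1]
  simp only [coboundary]
  rw [Finset.sum_congr rfl fun x _ => this x, Finset.sum_add_distrib]
  simp

theorem coboundary_one (G : SimpleGraph V) (e : GraphEdge G) : coboundary (fun _ => 1) e.1 = 0 := by
  obtain ⟨e, he⟩ := e
  induction e with | _ a b
  rw [coboundary_mk _ (G.ne_of_adj (by simpa using he))]
  rfl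

theorem mulVec_incidence (G : SimpleGraph V) (w : V → ZMod 2) (e : GraphEdge G) :
    (incidence G).mulVec w e = coboundary w e.1 := by
  classical
  simp [Matrix.mulVec, dotProduct, incidence, coboundary]

open Classical in
/-- Every vertex meets an even number of edges of the set. -/
def IsEvenEdgeSet (c : Finset (Sym2 V)) : Prop :=
  ∀ x, ((c.filter fun e => x ∈ e).card : ZMod 2) = 0

-- Double counting of incidences. Pairing an edge set with the coboundaries of all potentials
-- detects its boundary; the boundary computations for paths, hops and adapter cycles are done in
-- this dual form.
open Classical in
theorem sum_coboundary (w : V → ZMod 2) (T : Finset (Sym2 V)) :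
    ∑ e ∈ T, coboundary w e = ∑ x, ((T.filter fun e => x ∈ e).card : ZMod 2) * w x := by
  simp only [coboundary]
  rw [Finset.sum_comm]
  refine Finset.sum_congr rfl fun x _ => ?_
  rw [← Finset.sum_filter]
  simp

theorem IsEvenEdgeSet.sum_coboundary {c : Finset (Sym2 V)} (h : IsEvenEdgeSet c)
    (w : V → ZMod 2) : ∑ e ∈ c, coboundary w e = 0 := by
  classical
  rw [_root_.sum_coboundary]
  exact Finset.sum_eq_zero fun x _ => by rw [h x, zero_mul]

open Classical in
theorem isEvenEdgeSet_of_sum_coboundary {c : Finset (Sym2 V)}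
    (h : ∀ w : V → ZMod 2, ∑ e ∈ c, coboundary w e = 0) : IsEvenEdgeSet c := fun x => by
  have := h (Pi.single x 1)
  rw [_root_.sum_coboundary, Finset.sum_eq_single x] at this
  · simpa using this
  · intro b _ hb
    simp [hb]
  · simp

theorem sum_edgeVec_mul (G : SimpleGraph V) {c : Finset (Sym2 V)} (hc : ∀ e ∈ c, e ∈ G.edgeSet)
    (y : Sym2 V → ZMod 2) : ∑ e, edgeVec G c e * y e.1 = ∑ e ∈ c, y e := by
  classical
  simp only [edgeVec, ite_mul, one_mul, zero_mul]
  rw [← Finset.sum_filter]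
  refine Finset.sum_bij (fun e _ => e.1) ?_ ?_ ?_ ?_
  · simp
  · intro a _ b _ h
    exact Subtype.ext h
  · intro e he
    exact ⟨⟨e, hc e he⟩, by simpa using he, rfl⟩
  · simp

theorem edgeVec_dotProduct_mulVec (G : SimpleGraph V) {c : Finset (Sym2 V)}
    (hc : ∀ e ∈ c, e ∈ G.edgeSet) (w : V → ZMod 2) :
    edgeVec G c ⬝ᵥ (incidence G).mulVec w = ∑ e ∈ c, coboundary w e := by
  rw [← sum_edgeVec_mul G hc]
  exact Finset.sum_congr rfl fun e _ => by rw [mulVec_incidence]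

theorem edgeVec_mem_ker_iff (G : SimpleGraph V) {c : Finset (Sym2 V)}
    (hc : ∀ e ∈ c, e ∈ G.edgeSet) :
    edgeVec G c ∈ LinearMap.ker (Matrix.vecMulLinear (incidence G)) ↔ IsEvenEdgeSet c := by
  rw [LinearMap.mem_ker, Matrix.vecMulLinear_apply]
  constructor
  · intro h
    refine isEvenEdgeSet_of_sum_coboundary fun w => ?_
    rw [← edgeVec_dotProduct_mulVec G hc, Matrix.dotProduct_mulVec, h, zero_dotProduct]
  · intro h
    refine dotProduct_eq_zero _ fun w => ?_
    rw [← Matrix.dotProduct_mulVec, edgeVec_dotProduct_mulVec G hc, h.sum_coboundary]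

/-- Vectors orthogonal to a cycle basis are coboundaries. -/
theorem IsCycleBasis.exists_mulVec {G : SimpleGraph V} {C : Finset (Finset (Sym2 V))}
    (h : IsCycleBasis G C) (z : GraphEdge G → ZMod 2) (hz : ∀ c ∈ C, edgeVec G c ⬝ᵥ z = 0) :
    ∃ w, (incidence G).mulVec w = z := by
  classical
  let φ : Module.Dual (ZMod 2) (GraphEdge G → ZMod 2) :=
    { toFun := fun v => v ⬝ᵥ z
      map_add' := fun a b => add_dotProduct a b z
      map_smul' := fun r a => smul_dotProduct r a z }
  have hφ : φ ∈ (LinearMap.ker (Matrix.vecMulLinear (incidence G))).dualAnnihilator := by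
    rw [← h.2, Submodule.mem_dualAnnihilator]
    intro v hv
    induction hv using Submodule.span_induction with
    | mem x hx =>
      obtain ⟨c, hc, rfl⟩ := hx
      exact hz c hc
    | zero => simp
    | add a b _ _ ha hb => rw [map_add, ha, hb, add_zero]
    | smul r a _ ha => rw [map_smul, ha, smul_zero]
  -- Pairing with `z` kills the cycle space, hence factors through the boundary map as some `ψ`; the
  -- potential is `ψ` on point vectors.
  rw [← LinearMap.range_dualMap_eq_dualAnnihilator_ker] at hφ
  obtain ⟨ψ, hψ⟩ := hφ
  refine ⟨fun x => ψ (Pi.single x 1), ?_⟩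
  ext e
  have h1 : φ (Pi.single e 1) = z e := by simp [φ]
  rw [← h1, ← hψ, LinearMap.dualMap_apply, LinearMap.pi_apply_eq_sum_univ ψ]
  simp only [Matrix.mulVec, dotProduct, smul_eq_mul, Matrix.vecMulLinear_apply,
    Matrix.single_one_vecMul]
  refine Finset.sum_congr rfl fun x _ => ?_
  congr 2
  ext y
  simp [Pi.single_apply, eq_comm]

/-- A family of even edge sets is a cycle basis if all vectors orthogonal to it are coboundaries. -/
theorem isCycleBasis_of_forall_exists {G : SimpleGraph V} {C : Finset (Finset (Sym2 V))}
    (hsub : ∀ c ∈ C, ∀ e ∈ c, e ∈ G.edgeSet) (heven : ∀ c ∈ C, IsEvenEdgeSet c)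
    (hcob : ∀ y : Sym2 V → ZMod 2, (∀ c ∈ C, ∑ e ∈ c, y e = 0) →
      ∃ w : V → ZMod 2, ∀ e ∈ G.edgeSet, y e = coboundary w e) : IsCycleBasis G C := by
  classical
  refine ⟨hsub, le_antisymm ?_ ?_⟩
  · rw [Submodule.span_le]
    rintro _ ⟨c, hc, rfl⟩
    exact (edgeVec_mem_ker_iff G (hsub c hc)).2 (heven c hc)
  · intro v hv
    by_contra hn
    -- A cycle outside the span is separated from it by a functional. Its values on single edges
    -- form a vector orthogonal to `C`, hence a coboundary, and a coboundary vanishes on every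
    -- cycle.
    obtain ⟨φ, hφv, hφ⟩ := Submodule.exists_le_ker_of_notMem hn
    let y : Sym2 V → ZMod 2 := fun e => if h : e ∈ G.edgeSet then φ (Pi.single ⟨e, h⟩ 1) else 0
    have hy : ∀ u, φ u = ∑ e, u e * y e.1 := by
      intro u
      rw [LinearMap.pi_apply_eq_sum_univ φ]
      refine Finset.sum_congr rfl fun e _ => ?_
      rw [smul_eq_mul]
      congr 1
      simp only [y, e.2, dif_pos]
      congr 1
      ext f
      simp [Pi.single_apply, eq_comm]
    obtain ⟨w, hw⟩ := hcob y fun c hc => by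
      rw [← sum_edgeVec_mul G (hsub c hc), ← hy]
      exact hφ (Submodule.subset_span ⟨c, hc, rfl⟩)
    apply hφv
    rw [hy]
    have : ∑ e, v e * y e.1 = v ⬝ᵥ (incidence G).mulVec w :=
      Finset.sum_congr rfl fun e _ => by rw [mulVec_incidence, hw e.1 e.2]
    rw [this, Matrix.dotProduct_mulVec]
    rw [LinearMap.mem_ker, Matrix.vecMulLinear_apply] at hv
    rw [hv, zero_dotProduct]

theorem IsCycleBasis.isEvenEdgeSet {G : SimpleGraph V} {C : Finset (Finset (Sym2 V))}
    (h : IsCycleBasis G C) {c : Finset (Sym2 V)} (hc : c ∈ C) : IsEvenEdgeSet c := by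
  rw [← edgeVec_mem_ker_iff G (h.1 c hc), ← h.2]
  exact Submodule.subset_span ⟨c, hc, rfl⟩

theorem IsCycleBasis.exists_coboundary {G : SimpleGraph V} {C : Finset (Finset (Sym2 V))}
    (h : IsCycleBasis G C) (y : Sym2 V → ZMod 2) (hy : ∀ c ∈ C, ∑ e ∈ c, y e = 0) :
    ∃ w : V → ZMod 2, ∀ e ∈ G.edgeSet, y e = coboundary w e := by
  obtain ⟨w, hw⟩ := h.exists_mulVec (fun e => y e.1) fun c hc => by
    rw [← hy c hc, ← sum_edgeVec_mul G (h.1 c hc)]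
    rfl
  exact ⟨w, fun e he => by rw [← mulVec_incidence G w ⟨e, he⟩, hw]⟩

/-- The sum telescopes in characteristic 2. Edges are counted with multiplicity, so the walk may
repeat them. -/
theorem SimpleGraph.Walk.sum_coboundary {G : SimpleGraph V} (w : V → ZMod 2) {a b : V}
    (p : G.Walk a b) : (p.edges.map (coboundary w)).sum = w a + w b := by
  induction p with
  | nil => simp [CharTwo.add_self_eq_zero]
  | @cons u v z h p ih =>
    rw [SimpleGraph.Walk.edges_cons, List.map_cons, List.sum_cons, ih,
      coboundary_mk w h.ne]
    have h2 : (2 : ZMod 2) = 0 := rfl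
    linear_combination w v * h2

/-- The edge set of a path has boundary the two end points. -/
theorem SimpleGraph.Walk.IsPath.sum_coboundary [DecidableEq (Sym2 V)] {G : SimpleGraph V}
    (w : V → ZMod 2) {a b : V} {p : G.Walk a b} (hp : p.IsPath) :
    ∑ e ∈ p.edges.toFinset, coboundary w e = w a + w b := by
  rw [← p.sum_coboundary w, List.sum_toFinset _ hp.edges_nodup]

/-- The boundary of a path matching is the set of matched vertices. -/
theorem IsPathMatching.sum_coboundary {G : SimpleGraph V} {T : Finset V} {μ : Finset (Sym2 V)}
    (h : IsPathMatching G T μ) (w : V → ZMod 2) :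
    ∑ e ∈ μ, coboundary w e = ∑ x ∈ T, w x := by
  classical
  obtain ⟨k, a, b, p, hp, hinj, hT, hdis, hμ⟩ := h
  have h1 : μ = Finset.univ.biUnion fun j => (p j).edges.toFinset := by
    ext e; simp [hμ]
  have h2 : T = Finset.univ.image (Sum.elim a b) := by
    ext x; simp [hT, exists_or]
  rw [h1, h2, Finset.sum_biUnion, Finset.sum_image fun x _ y _ h => hinj h, Fintype.sum_sum_type,
    ← Finset.sum_add_distrib]
  · exact Finset.sum_congr rfl fun j _ => (hp j).sum_coboundary w
  · intro j _ j' _ hjj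
    rw [Function.onFun, Finset.disjoint_left]
    intro e he he'
    exact hdis j j' hjj e (by simpa using he) (by simpa using he')

end CycleSpace

theorem IsPathMatching.subset_edgeSet {V : Type*} {G : SimpleGraph V} {T : Finset V} {μ : Finset (Sym2 V)}
    (h : IsPathMatching G T μ) : ∀ e ∈ μ, e ∈ G.edgeSet := by
  obtain ⟨k, a, b, p, hp, hinj, hT, hdis, hμ⟩ := h
  intro e he
  obtain ⟨j, hj⟩ := (hμ e).1 he
  exact (p j).edges_subset_edgeSet hj

end

noncomputable section

/-! ### The deformed code -/

theorem ZMod.eq_one_of_two_of_ne_zero {a : ZMod 2} (h : a ≠ 0) : a = 1 := by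
  revert a; decide

/-- Rank-nullity for `f` restricted to `D`. Applied twice, it splits the rank of the deformed
stabilizer group into three computable parts. -/
theorem Submodule.finrank_map_add_finrank_inf_ker {k M N : Type*} [DivisionRing k]
    [AddCommGroup M] [Module k M] [AddCommGroup N] [Module k N] [FiniteDimensional k M]
    (D : Submodule k M) (f : M →ₗ[k] N) :
    Module.finrank k (D.map f) + Module.finrank k (D ⊓ LinearMap.ker f : Submodule k M) =
      Module.finrank k D := by
  have h := LinearMap.finrank_range_add_finrank_ker (f.domRestrict D)
  rw [LinearMap.range_domRestrict] at h
  rw [← h]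
  congr 1
  have : (D ⊓ LinearMap.ker f : Submodule k M) =
      (LinearMap.ker (f.domRestrict D)).map D.subtype := by
    ext x
    simp only [Submodule.mem_inf, LinearMap.mem_ker, Submodule.mem_map]
    exact ⟨fun ⟨h1, h2⟩ => ⟨⟨x, h1⟩, h2, rfl⟩, by rintro ⟨y, hy, rfl⟩; exact ⟨y.2, hy⟩⟩
  rw [this, Submodule.finrank_map_subtype_eq]

namespace Pauli

variable {Q : Type*} [Fintype Q]

theorem mem_support {P : Pauli Q} {q : Q} : q ∈ P.support ↔ P.1 q ≠ 0 ∨ P.2 q ≠ 0 := by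
  simp [support]

theorem mem_xSupport {P : Pauli Q} {q : Q} : q ∈ P.xSupport ↔ P.1 q ≠ 0 := by
  simp [xSupport]

theorem symp_add_right (P R R' : Pauli Q) : P.symp (R + R') = P.symp R + P.symp R' := by
  simp only [symp, ← Finset.sum_add_distrib]
  refine Finset.sum_congr rfl fun q _ => ?_
  simp only [Prod.fst_add, Prod.snd_add, Pi.add_apply]
  ring

theorem symp_smul_right (r : ZMod 2) (P R : Pauli Q) : P.symp (r • R) = r * P.symp R := by
  simp only [symp, Finset.mul_sum]
  refine Finset.sum_congr rfl fun q _ => ?_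
  simp only [Prod.smul_fst, Prod.smul_snd, Pi.smul_apply, smul_eq_mul]
  ring

theorem symp_comm (P R : Pauli Q) : P.symp R = R.symp P :=
  Finset.sum_congr rfl fun q _ => by ring

/-- The symplectic product with a fixed operator, as a linear functional. -/
def sympLinear (P : Pauli Q) : Pauli Q →ₗ[ZMod 2] ZMod 2 where
  toFun := P.symp
  map_add' := P.symp_add_right
  map_smul' r R := P.symp_smul_right r R

theorem symp_eq_zero_of_mem_stabilizerGroup {S : Type*} {check : S → Pauli Q} {P R : Pauli Q}
    (h : ∀ s, P.symp (check s) = 0) (hR : R ∈ stabilizerGroup check) : P.symp R = 0 := by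
  have : stabilizerGroup check ≤ LinearMap.ker P.sympLinear :=
    Submodule.span_le.2 (by rintro _ ⟨s, rfl⟩; exact h s)
  exact this hR

end Pauli

namespace AuxGraph

variable {Q S V : Type*} (A : AuxGraph Q S V)

/-- The restriction of an operator of the deformed code to the original qubits. -/
def restrict : Pauli A.Qubit →ₗ[ZMod 2] Pauli Q where
  toFun P := (fun q => P.1 (.inl q), fun q => P.2 (.inl q))
  map_add' _ _ := rfl
  map_smul' _ _ := rfl

/-- The `Z`-part of an operator on the edge qubits. -/
def edgeZ : Pauli A.Qubit →ₗ[ZMod 2] (GraphEdge A.graph → ZMod 2) where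
  toFun P := fun e => P.2 (.inr e)
  map_add' _ _ := rfl
  map_smul' _ _ := rfl

/-- The `X`-part of an operator on the edge qubits. -/
def edgeX : Pauli A.Qubit →ₗ[ZMod 2] (GraphEdge A.graph → ZMod 2) where
  toFun P := fun e => P.1 (.inr e)
  map_add' _ _ := rfl
  map_smul' _ _ := rfl

/-- The `X`-type operator on the edge qubits with given support vector. -/
def edgeXOp : (GraphEdge A.graph → ZMod 2) →ₗ[ZMod 2] Pauli A.Qubit where
  toFun y := (Sum.elim 0 y, 0)
  map_add' y z := by ext q <;> cases q <;> simp
  map_smul' r y := by ext q <;> cases q <;> simp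

variable {A} in
theorem ext_restrict {P R : Pauli A.Qubit} (h1 : A.restrict P = A.restrict R)
    (h2 : A.edgeX P = A.edgeX R) (h3 : A.edgeZ P = A.edgeZ R) : P = R := by
  ext q
  · cases q with
    | inl q => exact congrFun (congrArg Prod.fst h1) q
    | inr e => exact congrFun h2 e
  · cases q with
    | inl q => exact congrFun (congrArg Prod.snd h1) q
    | inr e => exact congrFun h3 e

/-- The `Z`-type operator induced on the original qubits by the vertex checks at the support of a
vertex vector. -/
def portZ (w : V → ZMod 2) : Pauli Q := (0, fun q => ∑ x ∈ A.port q, w x)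

@[simp] theorem restrict_edgeXOp (y) : A.restrict (A.edgeXOp y) = 0 := rfl
@[simp] theorem edgeX_edgeXOp (y) : A.edgeX (A.edgeXOp y) = y := rfl
@[simp] theorem edgeZ_edgeXOp (y) : A.edgeZ (A.edgeXOp y) = 0 := rfl
@[simp] theorem restrict_original (check : S → Pauli Q) (s : S) :
    A.restrict (A.deformedOriginalCheck check s) = check s := rfl
@[simp] theorem edgeX_original (check : S → Pauli Q) (s : S) :
    A.edgeX (A.deformedOriginalCheck check s) = edgeVec A.graph (A.matching s) := rfl
@[simp] theorem edgeZ_original (check : S → Pauli Q) (s : S) :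
    A.edgeZ (A.deformedOriginalCheck check s) = 0 := rfl

theorem cycleCheck_eq (c : Finset (Sym2 V)) : A.cycleCheck c = A.edgeXOp (edgeVec A.graph c) := rfl

/-- Only the X-part of `P` contributes, and disjointness of the ports turns the double sum over
qubits and their vertices into one sum. -/
theorem symp_portZ [Fintype Q] (P : Pauli Q) (w : V → ZMod 2)
    (hdis : ∀ q q', q ≠ q' → Disjoint (A.port q) (A.port q')) :
    P.symp (A.portZ w) = ∑ x ∈ A.portOf P.xSupport, w x := by
  classical
  rw [portOf, Finset.sum_biUnion fun q _ q' _ h => hdis q q' h, Pauli.xSupport, Finset.sum_filter]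
  refine Finset.sum_congr rfl fun q _ => ?_
  simp only [portZ, Pi.zero_apply, mul_zero, add_zero]
  split_ifs with h
  · rw [ZMod.eq_one_of_two_of_ne_zero h, one_mul]
  · rw [not_not.1 h, zero_mul]

variable [Fintype V]

/-- The product of the vertex checks at the support of a vertex vector. -/
def vertexOp (w : V → ZMod 2) : Pauli A.Qubit := ∑ x, w x • A.vertexCheck x

@[simp] theorem restrict_vertexOp (w : V → ZMod 2) : A.restrict (A.vertexOp w) = A.portZ w := by
  classical
  rw [vertexOp, map_sum]
  ext q
  · simp [restrict, portZ, vertexCheck, Prod.fst_sum]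
  · simp only [restrict, vertexCheck, LinearMap.coe_mk, AddHom.coe_mk, Pi.zero_apply,
      Sum.elim_inl, Prod.smul_mk, Prod.snd_sum, Finset.sum_apply, Pi.smul_apply, smul_eq_mul,
      mul_ite, mul_one, mul_zero, portZ]
    rw [← Finset.sum_filter]
    congr 1
    ext; simp

@[simp] theorem edgeX_vertexOp (w : V → ZMod 2) : A.edgeX (A.vertexOp w) = 0 := by
  rw [vertexOp, map_sum]
  ext e
  simp [edgeX, vertexCheck]

@[simp] theorem edgeZ_vertexOp (w : V → ZMod 2) :
    A.edgeZ (A.vertexOp w) = (incidence A.graph).mulVec w := by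
  rw [vertexOp, map_sum]
  ext e
  simp [edgeZ, vertexCheck, Matrix.mulVec, dotProduct, mul_comm]

theorem symp_eq [Fintype Q] (P R : Pauli A.Qubit) :
    P.symp R = (A.restrict P).symp (A.restrict R) +
      (A.edgeX P ⬝ᵥ A.edgeZ R + A.edgeX R ⬝ᵥ A.edgeZ P) := by
  simp only [Pauli.symp, Fintype.sum_sum_type, dotProduct, ← Finset.sum_add_distrib]
  congr 1
  refine Finset.sum_congr rfl fun e _ => ?_
  simp only [edgeX, edgeZ, LinearMap.coe_mk, AddHom.coe_mk]
  ring

theorem vertexOp_single {A : AuxGraph Q S V} [DecidableEq V] (x : V) :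
    A.vertexOp (Pi.single x 1) = A.vertexCheck x := by
  rw [vertexOp, Finset.sum_eq_single x]
  · simp
  · intro y _ hy
    simp [hy]
  · simp

theorem vertexOp_mem {A : AuxGraph Q S V} {check : S → Pauli Q} (w : V → ZMod 2) :
    A.vertexOp w ∈ stabilizerGroup (A.deformed check) :=
  Submodule.sum_mem _ fun x _ => Submodule.smul_mem _ _
    (Submodule.subset_span ⟨.inr (.inl x), rfl⟩)

/-- An operator that acts only as `X` on the edge qubits and commutes with the vertex checks is
a cycle. -/
theorem exists_edgeXOp [Fintype Q] {A : AuxGraph Q S V} {P : Pauli A.Qubit}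
    (h1 : A.restrict P = 0) (h2 : A.edgeZ P = 0)
    (h3 : ∀ x, (A.vertexCheck x).symp P = 0) :
    A.edgeX P ∈ LinearMap.ker (Matrix.vecMulLinear (incidence A.graph)) ∧
      P = A.edgeXOp (A.edgeX P) := by
  classical
  refine ⟨?_, ext_restrict (by simp [h1]) (by simp) (by simp [h2])⟩
  rw [LinearMap.mem_ker, Matrix.vecMulLinear_apply]
  ext x
  have h := h3 x
  rw [← vertexOp_single, symp_eq] at h
  simp only [h1, h2, edgeX_vertexOp, edgeZ_vertexOp, Matrix.mulVec_single_one] at h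
  simpa [Pauli.symp, dotProduct, Matrix.vecMul, Matrix.col] using h

variable [Fintype Q] [Fintype S] {A} {check : S → Pauli Q} {L : Finset Q} {d : ℕ} {K : DesiderataBounds}

namespace SatisfiesDesiderata

/-- The boundary of the matching is the port of the X-support, so the sign picked up on the edges
equals the one picked up on the original qubits. This is why the deformed checks commute with the
vertex checks. -/
theorem matching_dotProduct (hA : A.SatisfiesDesiderata check L d K) (s : S) (w : V → ZMod 2) :
    edgeVec A.graph (A.matching s) ⬝ᵥ (incidence A.graph).mulVec w =
      (check s).symp (A.portZ w) := by
  rw [edgeVec_dotProduct_mulVec _ (hA.isPathMatching s).subset_edgeSet,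
    (hA.isPathMatching s).sum_coboundary, A.symp_portZ _ _ hA.port_disjoint]

theorem symp_original_vertexOp (hA : A.SatisfiesDesiderata check L d K) (s : S) (w : V → ZMod 2) :
    (A.deformedOriginalCheck check s).symp (A.vertexOp w) = 0 := by
  rw [symp_eq]
  simp [hA.matching_dotProduct, CharTwo.add_self_eq_zero]

theorem symp_cycle_vertexOp (hA : A.SatisfiesDesiderata check L d K)
    {c : Finset (Sym2 V)} (hc : c ∈ A.cycles) (w : V → ZMod 2) :
    (A.cycleCheck c).symp (A.vertexOp w) = 0 := by
  rw [symp_eq, cycleCheck_eq]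
  simp only [restrict_edgeXOp, edgeX_edgeXOp, edgeZ_edgeXOp, edgeZ_vertexOp, edgeX_vertexOp]
  rw [edgeVec_dotProduct_mulVec _ (hA.isCycleBasis.1 c hc),
    (hA.isCycleBasis.isEvenEdgeSet hc).sum_coboundary]
  simp [Pauli.symp]

end SatisfiesDesiderata

namespace SatisfiesDesiderata

theorem checksCommute_deformed (hA : A.SatisfiesDesiderata check L d K) (hcomm : ChecksCommute check) :
    ChecksCommute (A.deformed check) := by
  classical
  -- Serves both the deformed original checks and the cycle checks: neither has a Z-part on the
  -- edges.
  have key : ∀ (P : Pauli A.Qubit), A.edgeZ P = 0 → (∀ w, P.symp (A.vertexOp w) = 0) →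
      (∀ s, (A.restrict P).symp (check s) = 0) → ∀ s', P.symp (A.deformed check s') = 0 := by
    rintro P h1 h2 h3 (s | x | ⟨c, hc⟩)
    · rw [deformed, symp_eq]
      simp [h1, h3]
    · rw [deformed, ← vertexOp_single]
      exact h2 _
    · rw [deformed, symp_eq, cycleCheck_eq]
      simp [h1, Pauli.symp]
  rintro (s | x | ⟨c, hc⟩)
  · exact key _ (by simp [deformed]) (fun w => hA.symp_original_vertexOp s w)
      (fun s' => hcomm s s')
  · rintro (s | y | ⟨c, hc⟩)
    · rw [Pauli.symp_comm, deformed, deformed, ← vertexOp_single]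
      exact hA.symp_original_vertexOp s _
    · rw [deformed, deformed, ← vertexOp_single, ← vertexOp_single, symp_eq]
      simp [portZ, Pauli.symp]
    · rw [Pauli.symp_comm, deformed, deformed, ← vertexOp_single]
      exact hA.symp_cycle_vertexOp hc _
  · exact key _ (by simp [deformed, cycleCheck_eq]) (fun w => hA.symp_cycle_vertexOp hc w)
      (fun s' => by simp [deformed, cycleCheck_eq, Pauli.symp])

theorem edgeXOp_mem (hA : A.SatisfiesDesiderata check L d K) {y : GraphEdge A.graph → ZMod 2}
    (hy : y ∈ LinearMap.ker (Matrix.vecMulLinear (incidence A.graph))) :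
    A.edgeXOp y ∈ stabilizerGroup (A.deformed check) := by
  rw [← hA.isCycleBasis.2] at hy
  have : Submodule.span (ZMod 2) (edgeVec A.graph '' (A.cycles : Set (Finset (Sym2 V)))) ≤
      (stabilizerGroup (A.deformed check)).comap A.edgeXOp := by
    rw [Submodule.span_le]
    rintro _ ⟨c, hc, rfl⟩
    exact Submodule.subset_span ⟨.inr (.inr ⟨c, hc⟩), rfl⟩
  exact this hy

/-- A normal form for stabilizers: the possibly redundant cycle checks are merged into one element
of the cycle space. -/
theorem mem_iff (hA : A.SatisfiesDesiderata check L d K) {P : Pauli A.Qubit} : P ∈ stabilizerGroup (A.deformed check) ↔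
    ∃ (σ : S → ZMod 2) (w : V → ZMod 2) (y : GraphEdge A.graph → ZMod 2),
      y ∈ LinearMap.ker (Matrix.vecMulLinear (incidence A.graph)) ∧
      P = ∑ s, σ s • A.deformedOriginalCheck check s + A.vertexOp w + A.edgeXOp y := by
  constructor
  · intro h
    rw [stabilizerGroup, Submodule.mem_span_range_iff_exists_fun] at h
    obtain ⟨r, rfl⟩ := h
    refine ⟨fun s => r (.inl s), fun x => r (.inr (.inl x)),
      ∑ c : {c // c ∈ A.cycles}, r (.inr (.inr c)) • edgeVec A.graph c.1, ?_, ?_⟩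
    · rw [← hA.isCycleBasis.2]
      exact Submodule.sum_mem _ fun c _ => Submodule.smul_mem _ _
        (Submodule.subset_span ⟨c.1, c.2, rfl⟩)
    · rw [Fintype.sum_sum_type, Fintype.sum_sum_type, ← add_assoc, map_sum]
      simp only [map_smul]
      rfl
  · rintro ⟨σ, w, y, hy, rfl⟩
    exact add_mem (add_mem (Submodule.sum_mem _ fun s _ => Submodule.smul_mem _ _
      (Submodule.subset_span ⟨.inl s, rfl⟩)) (vertexOp_mem w)) (hA.edgeXOp_mem hy)

/-- The cleaning lemma. Multiplication by the vertex checks on `w` removes all Z from the edges;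
commutation with the deformed checks then becomes commutation with the original ones, because X on
the edges commutes with the matchings. -/
theorem isNontrivialLogical_restrict (hA : A.SatisfiesDesiderata check L d K)
    (hcomm : ChecksCommute check) {P : Pauli A.Qubit}
    (hP : IsNontrivialLogical (A.deformed check) P) {w : V → ZMod 2}
    (hw : (incidence A.graph).mulVec w = A.edgeZ P) :
    IsNontrivialLogical check (A.restrict P + A.portZ w) := by
  constructor
  · intro s
    have h : (A.deformedOriginalCheck check s).symp P = 0 := hP.1 (.inl s)
    rw [symp_eq] at h
    simp only [restrict_original, edgeX_original, edgeZ_original, ← hw,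
      hA.matching_dotProduct, dotProduct_zero, add_zero] at h
    rw [Pauli.symp_add_right, h]
  · intro hmem
    rw [stabilizerGroup, Submodule.mem_span_range_iff_exists_fun] at hmem
    obtain ⟨σ, hσ⟩ := hmem
    set T := ∑ s, σ s • A.deformedOriginalCheck check s + A.vertexOp w with hT
    have hTm : T ∈ stabilizerGroup (A.deformed check) :=
      add_mem (Submodule.sum_mem _ fun s _ => Submodule.smul_mem _ _
        (Submodule.subset_span ⟨.inl s, rfl⟩)) (vertexOp_mem w)
    -- If the cleaned operator were a product of checks, the same product of deformed checks would
    -- leave only X on the edges. Commuting with the vertex checks, this remainder is a cycle, hence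
    -- a stabilizer.
    obtain ⟨h3, h4⟩ := exists_edgeXOp (P := P + T) (by
      simp only [hT, map_add, map_sum, map_smul, restrict_original, hσ, restrict_vertexOp]
      rw [add_assoc, ZModModule.add_self, add_zero, ZModModule.add_self]) (by
      simp only [hT, map_add, map_sum, map_smul, edgeZ_original, edgeZ_vertexOp, hw]
      simp [ZModModule.add_self]) (by
      intro x
      rw [Pauli.symp_add_right, show (A.vertexCheck x).symp P = 0 from hP.1 (.inr (.inl x)),
        Pauli.symp_eq_zero_of_mem_stabilizerGroup (P := A.vertexCheck x) (check := A.deformed check)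
          (fun s => hA.checksCommute_deformed hcomm (.inr (.inl x)) s) hTm, add_zero])
    refine hP.2 ((Submodule.add_mem_iff_left _ hTm).1 ?_)
    rw [h4]
    exact hA.edgeXOp_mem h3

end SatisfiesDesiderata

end AuxGraph
end

/-! ### Distance, logical qubits and sparsity of the deformed code -/

noncomputable section

namespace Pauli

theorem weight_add_le {Q : Type*} [Fintype Q] (P R : Pauli Q) : (P + R).weight ≤ P.weight + R.weight := by
  classical
  refine (Finset.card_le_card fun q hq => ?_).trans (Finset.card_union_le P.support R.support)
  rw [Finset.mem_union, mem_support, mem_support]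
  rw [mem_support] at hq
  by_contra h
  push Not at h
  simp [h] at hq

end Pauli

namespace AuxGraph

theorem card_filter_check_le {Q S V : Type*} [Fintype S] [Fintype V] {A : AuxGraph Q S V}
    {p : A.Check → Prop} {_ : DecidablePred p} {m n k : ℕ}
    (h1 : (Finset.univ.filter fun s => p (.inl s)).card ≤ m)
    (h2 : (Finset.univ.filter fun x => p (.inr (.inl x))).card ≤ n)
    (h3 : (Finset.univ.filter fun c => p (.inr (.inr c))).card ≤ k) :
    (Finset.univ.filter p).card ≤ m + n + k := by
  simp only [Finset.card_filter, Fintype.sum_sum_type] at h1 h2 h3 ⊢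
  omega

variable {Q S V : Type*} [Fintype Q] {A : AuxGraph Q S V}
  {check : S → Pauli Q} {d : ℕ} {K : DesiderataBounds}

-- Each qubit in the support has an attached vertex with nonzero `w`, and vertices of distinct
-- qubits are distinct.
open Classical in
theorem weight_portZ_le (hdis : ∀ q q', q ≠ q' → Disjoint (A.port q) (A.port q'))
    (w : V → ZMod 2) :
    (A.portZ w).weight ≤ ((A.portOf Finset.univ).filter fun x => w x ≠ 0).card := by
  rw [portOf, Finset.filter_biUnion, Finset.card_biUnion, Pauli.weight, Finset.card_eq_sum_ones,
    Pauli.support, Finset.sum_filter]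
  · refine Finset.sum_le_sum fun q _ => ?_
    split_ifs with h
    · obtain ⟨x, hx, hw⟩ := Finset.exists_ne_zero_of_sum_ne_zero
        (show ∑ x ∈ A.port q, w x ≠ 0 by simpa [portZ] using h)
      exact Finset.card_pos.2 ⟨x, Finset.mem_filter.2 ⟨hx, hw⟩⟩
    · exact Nat.zero_le _
  · exact fun q _ q' _ h => Finset.disjoint_filter_filter (hdis q q' h)

theorem portZ_one_of_parity {Z : Pauli Q} (hZ : Z.IsZType)
    (hpar : ∀ q, Odd (A.port q).card ↔ q ∈ Z.support) : A.portZ (fun _ => 1) = Z := by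
  refine Prod.ext hZ.symm (funext fun q => ?_)
  have hZq : Z.1 q = 0 := congrFun hZ q
  have h := hpar q
  rw [Pauli.mem_support, hZq] at h
  simp only [portZ, Finset.sum_const, nsmul_eq_mul, mul_one]
  by_cases h1 : Z.2 q = 0
  · rw [h1, ZMod.natCast_eq_zero_iff_even, ← Nat.not_odd_iff_even, h]
    simp [h1]
  · rw [ZMod.eq_one_of_two_of_ne_zero h1, ZMod.natCast_eq_one_iff_odd, h]
    simp [h1]

variable [Fintype V]

open Classical in
theorem weight_eq (P : Pauli A.Qubit) : P.weight = (A.restrict P).weight +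
    (Finset.univ.filter fun e : GraphEdge A.graph => A.edgeX P e ≠ 0 ∨ A.edgeZ P e ≠ 0).card := by
  simp only [Pauli.weight, Pauli.support, Finset.card_filter, Fintype.sum_sum_type]
  rfl

open Classical in
theorem le_weight (P : Pauli A.Qubit) : (A.restrict P).weight +
    (Finset.univ.filter fun e : GraphEdge A.graph => A.edgeZ P e ≠ 0).card ≤ P.weight := by
  rw [weight_eq]
  gcongr with e
  exact fun h => Or.inr h

variable [Fintype S]

namespace SatisfiesDesiderata

theorem sum_vertexCheck {Z : Pauli Q} (hA : A.SatisfiesDesiderata check Z.support d K)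
    (hZ : Z.IsZType) : ∑ x, A.vertexCheck x = A.extend Z := by
  have : ∑ x, A.vertexCheck x = A.vertexOp (fun _ => 1) := by simp [vertexOp]
  rw [this]
  refine ext_restrict ?_ ?_ ?_
  · rw [restrict_vertexOp, portZ_one_of_parity hZ hA.port_parity]
    rfl
  · rw [edgeX_vertexOp]
    rfl
  · rw [edgeZ_vertexOp]
    ext e
    rw [mulVec_incidence, coboundary_one]
    rfl

/-- The distance of the deformed code. -/
theorem le_codeDistance_deformed {L : Finset Q} (hA : A.SatisfiesDesiderata check L d K)
    (hcomm : ChecksCommute check) (hd : (d : ℕ∞) ≤ codeDistance check) :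
    (d : ℕ∞) ≤ codeDistance (A.deformed check) := by
  classical
  refine le_iInf₂ fun P hP => ?_
  rw [Nat.cast_le]
  have hd' : ∀ R, IsNontrivialLogical check R → d ≤ R.weight := fun R hR => by
    simpa using hd.trans (iInf₂_le R hR)
  obtain ⟨w, hw⟩ := hA.isCycleBasis.exists_mulVec (A.edgeZ P) fun c hc => by
    have h : (A.cycleCheck c).symp P = 0 := hP.1 (.inr (.inr ⟨c, hc⟩))
    rw [symp_eq, cycleCheck_eq] at h
    simpa [Pauli.symp] using h
  have key : ∀ w, (incidence A.graph).mulVec w = A.edgeZ P → d ≤ (A.restrict P).weight +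
      ((A.portOf Finset.univ).filter fun x => w x ≠ 0).card := fun w hw =>
    (hd' _ (hA.isNontrivialLogical_restrict hcomm hP hw)).trans
      ((Pauli.weight_add_le _ _).trans (Nat.add_le_add_left (weight_portZ_le hA.port_disjoint w) _))
  have h1 := key w hw
  -- The constant potential has zero coboundary, so the complementary vertex set cleans the same
  -- operator.
  have h2 := key (w + fun _ => 1) (by
    rw [Matrix.mulVec_add, hw]
    ext e
    rw [Pi.add_apply, mulVec_incidence, coboundary_one, add_zero])
  have h3 : ((A.portOf Finset.univ).filter fun x => (w + fun _ : V => (1 : ZMod 2)) x ≠ 0) =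
      (A.portOf Finset.univ).filter fun x => w x = 0 := by
    refine Finset.filter_congr fun x _ => ?_
    rw [Pi.add_apply]
    generalize w x = a
    revert a
    decide
  rw [h3] at h2
  -- The edges acted on by Z are the cut of `w`. They number at least `d`, or at least the loss in
  -- weight allowed by `h1` or by `h2`.
  have h4 := hA.expansion w
  rw [one_mul, Nat.cast_le, hw] at h4
  have h5 := le_weight P
  omega

/-- The deformed stabilizer group is filtered by its Z-part on the edges and then by its restriction
to `Q`. The three pieces are the coboundaries, the original group enlarged by `Z`, and the cycle
space. The first and last dimensions add up to the number of edges, so the new qubits cancel and the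
rank gains one. -/
theorem numLogical_deformed {Z : Pauli Q} (hA : A.SatisfiesDesiderata check Z.support d K)
    (hZ : Z.IsZType) (hcomm : ChecksCommute check) (hnt : Z ∉ stabilizerGroup check) :
    numLogical (A.deformed check) = numLogical check - 1 := by
  classical
  set D := stabilizerGroup (A.deformed check) with hD
  have h1 := Submodule.finrank_map_add_finrank_inf_ker D A.edgeZ
  have h2 := Submodule.finrank_map_add_finrank_inf_ker (D ⊓ LinearMap.ker A.edgeZ) A.restrict
  have m1 : D.map A.edgeZ = LinearMap.range (Matrix.mulVecLin (incidence A.graph)) := by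
    ext z
    rw [Submodule.mem_map, LinearMap.mem_range]
    constructor
    · rintro ⟨P, hP, rfl⟩
      obtain ⟨σ, w, y, -, rfl⟩ := hA.mem_iff.1 hP
      exact ⟨w, by simp⟩
    · rintro ⟨w, rfl⟩
      exact ⟨A.vertexOp w, vertexOp_mem w, by simp⟩
  have hvert : A.edgeZ (A.vertexOp fun _ => 1) = 0 := by
    rw [edgeZ_vertexOp]
    ext e
    rw [mulVec_incidence, coboundary_one]
    rfl
  have m2 : (D ⊓ LinearMap.ker A.edgeZ).map A.restrict =
      stabilizerGroup check ⊔ Submodule.span (ZMod 2) {Z} := by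
    apply le_antisymm
    · rintro _ ⟨P, ⟨hP, hk⟩, rfl⟩
      obtain ⟨σ, w, y, -, rfl⟩ := hA.mem_iff.1 hP
      have hk' : (incidence A.graph).mulVec w = 0 := by simpa using hk
      have hadj : ∀ a b, A.graph.Adj a b → w a = w b := fun a b hab => by
        have := congrFun hk' ⟨s(a, b), hab⟩
        rw [mulVec_incidence, coboundary_mk _ hab.ne] at this
        exact CharTwo.add_eq_zero.1 this
      -- By connectedness the only products of vertex checks without Z on edges are the empty one
      -- and the full one, which gives `Z`.
      have hconst : ∀ a b, w a = w b := fun a b => by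
        obtain ⟨p⟩ := hA.connected.preconnected a b
        induction p with
        | nil => rfl
        | cons h _ ih => exact (hadj _ _ h).trans ih
      obtain ⟨x₀⟩ := hA.connected.nonempty
      have hw : w = w x₀ • fun _ => 1 := by
        ext x
        simp [hconst x x₀]
      have hport : A.portZ w = w x₀ • Z := by
        rw [← portZ_one_of_parity hZ hA.port_parity, ← restrict_vertexOp, ← restrict_vertexOp,
          ← map_smul]
        congr 1
        rw [hw]
        simp [vertexOp, Finset.smul_sum]
      simp only [map_add, map_sum, map_smul, restrict_original, restrict_vertexOp,
        restrict_edgeXOp, add_zero, hport]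
      exact Submodule.add_mem_sup
        (Submodule.sum_mem _ fun s _ => Submodule.smul_mem _ _ (Submodule.subset_span ⟨s, rfl⟩))
        (Submodule.smul_mem _ _ (Submodule.mem_span_singleton_self Z))
    · rw [sup_le_iff, stabilizerGroup, Submodule.span_le, Submodule.span_singleton_le_iff_mem]
      constructor
      · rintro _ ⟨s, rfl⟩
        exact ⟨A.deformedOriginalCheck check s,
          ⟨Submodule.subset_span ⟨.inl s, rfl⟩, by simp⟩, by simp⟩
      · exact ⟨A.vertexOp fun _ => 1, ⟨vertexOp_mem _, hvert⟩, by
          rw [restrict_vertexOp, portZ_one_of_parity hZ hA.port_parity]⟩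
  have m3 : (D ⊓ LinearMap.ker A.edgeZ) ⊓ LinearMap.ker A.restrict =
      (LinearMap.ker (Matrix.vecMulLinear (incidence A.graph))).map A.edgeXOp := by
    apply le_antisymm
    · rintro P ⟨⟨hP, hk⟩, hr⟩
      obtain ⟨h3, h4⟩ := exists_edgeXOp (LinearMap.mem_ker.1 hr) hk fun x =>
        Pauli.symp_eq_zero_of_mem_stabilizerGroup (P := A.vertexCheck x) (check := A.deformed check)
          (fun s => hA.checksCommute_deformed hcomm (.inr (.inl x)) s) hP
      exact ⟨_, h3, h4.symm⟩
    · rintro _ ⟨y, hy, rfl⟩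
      exact ⟨⟨hA.edgeXOp_mem hy, by simp⟩, by simp⟩
  have hinj : Function.Injective A.edgeXOp := fun y z h => by
    simpa using congrArg A.edgeX h
  have h3 := LinearMap.finrank_range_add_finrank_ker (Matrix.vecMulLinear (incidence A.graph))
  -- Row rank equals column rank, so coboundaries and cycles have complementary dimensions.
  have h4 : Module.finrank (ZMod 2)
      (LinearMap.range (Matrix.vecMulLinear (incidence A.graph))) =
      Module.finrank (ZMod 2) (LinearMap.range (Matrix.mulVecLin (incidence A.graph))) := by
    have := Matrix.rank_transpose (incidence A.graph)
    rw [Matrix.rank, Matrix.rank, Matrix.mulVecLin_transpose] at this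
    exact this
  rw [m1] at h1
  rw [m2, m3, Submodule.finrank_sup_span_singleton hnt,
    ← (Submodule.equivMapOfInjective A.edgeXOp hinj _).finrank_eq] at h2
  rw [h4, Module.finrank_fintype_fun_eq_card] at h3
  rw [numLogical, numLogical, Fintype.card_sum, ← hD]
  omega

/-- The bounds for the different kinds of checks, and for original and edge qubits, are simply added
up; the 2 counts the end points of an edge. -/
theorem isLDPC_deformed {L : Finset Q} (hA : A.SatisfiesDesiderata check L d K) {α β : ℕ}
    (h : IsLDPC check α β) :
    IsLDPC (A.deformed check) (α + K.matchSize + (K.degree + 1) + K.cycleLength)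
      (β + K.portSize + K.matchOverlap + 2 + K.cycleOverlap) := by
  classical
  have hedge : ∀ c : Finset (Sym2 V), (Finset.univ.filter fun e : GraphEdge A.graph =>
      edgeVec A.graph c e ≠ 0).card ≤ c.card := fun c =>
    Finset.card_le_card_of_injOn (fun e => e.1) (fun e he => by
      by_contra h
      simp [edgeVec] at he
      exact h he) fun a _ b _ h => Subtype.ext h
  constructor
  · rintro (s | x | ⟨c, hc⟩)
    · have h1 := h.1 s
      have h2 := (hedge (A.matching s)).trans (hA.matchSize_le s)
      rw [weight_eq]
      simp only [deformed, restrict_original, edgeX_original, edgeZ_original, Pi.zero_apply,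
        ne_eq, not_true_eq_false, or_false] at h2 ⊢
      omega
    · have h1 : (A.restrict (A.vertexCheck x)).weight ≤ 1 := by
        rw [Pauli.weight, Finset.card_le_one]
        intro q hq q' hq'
        by_contra hne
        simp [Pauli.mem_support, restrict, vertexCheck] at hq hq'
        exact Finset.disjoint_left.1 (hA.port_disjoint q q' hne) hq hq'
      have h2 : (Finset.univ.filter fun e : GraphEdge A.graph =>
          A.edgeX (A.vertexCheck x) e ≠ 0 ∨ A.edgeZ (A.vertexCheck x) e ≠ 0).card ≤ K.degree := by
        refine le_trans ?_ (hA.degree_le x)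
        refine le_trans (Finset.card_le_card_of_injOn (fun e => e.1)
          (t := (Finset.univ.filter fun y => A.graph.Adj x y).image fun y => s(x, y)) ?_ ?_)
          Finset.card_image_le
        · rintro ⟨e, he⟩ hx
          have hx' : x ∈ e := by
            by_contra hn
            simp [edgeX, edgeZ, vertexCheck, incidence, hn] at hx
          obtain ⟨y, rfl⟩ := hx'
          simp only [Finset.coe_image, Finset.coe_filter, Finset.mem_univ, true_and]
          exact ⟨y, he, rfl⟩
        · exact fun a _ b _ h => Subtype.ext h
      rw [deformed, weight_eq]
      omega
    · have h2 := (hedge c).trans (hA.cycleLength_le c hc)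
      rw [deformed, weight_eq, cycleCheck_eq]
      simp only [restrict_edgeXOp, edgeX_edgeXOp, edgeZ_edgeXOp, Pi.zero_apply,
        ne_eq, not_true_eq_false, or_false] at h2 ⊢
      have : (0 : Pauli Q).weight = 0 := by simp [Pauli.weight, Pauli.support]
      omega
  · rintro (q | ⟨e, he⟩)
    · refine (card_filter_check_le (m := β) (n := K.portSize) (k := 0) ?_ ?_ ?_).trans (by omega)
      · refine le_trans (le_of_eq ?_) (h.2 q)
        congr 1
        ext s
        simp [Pauli.mem_support, deformed, deformedOriginalCheck]
      · refine le_trans (Finset.card_le_card fun x hx => ?_) (hA.port_le q)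
        by_contra hn
        simp [Pauli.mem_support, deformed, vertexCheck, hn] at hx
      · simp [Pauli.mem_support, deformed, cycleCheck]
    · refine (card_filter_check_le (m := K.matchOverlap) (n := 2) (k := K.cycleOverlap)
        ?_ ?_ ?_).trans (by omega)
      · refine le_trans (Finset.card_le_card fun s hs => ?_) (hA.matchOverlap_le e)
        by_contra hn
        simp only [Finset.mem_filter, Finset.mem_univ, true_and] at hn
        simp [Pauli.mem_support, deformed, deformedOriginalCheck, edgeVec, hn] at hs
      · induction e with | _ a b
        refine le_trans (Finset.card_le_card (t := {a, b}) fun x hx => ?_) Finset.card_le_two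
        by_contra hn
        simp only [Finset.mem_insert, Finset.mem_singleton] at hn
        simp [Pauli.mem_support, deformed, vertexCheck, incidence] at hx
        tauto
      · refine le_trans (Finset.card_le_card_of_injOn (fun c => c.1) (fun c hc => ?_)
          fun a _ b _ h => Subtype.ext h) (hA.cycleOverlap_le e)
        by_contra hn
        simp only [Finset.coe_filter, Set.mem_ofPred_eq, c.2, true_and] at hn
        simp [Pauli.mem_support, deformed, cycleCheck, edgeVec, hn] at hc

end SatisfiesDesiderata

end AuxGraph
end

noncomputable section

/-! ### SkipTree orders -/

/-- Trees in a graph with root and vertex set, built by joining two rooted trees by an edge. -/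
inductive IsRootedTree {V : Type*} [DecidableEq V] (G : SimpleGraph V) : V → Finset V → Prop
  | single (u : V) : IsRootedTree G u {u}
  | join {u v : V} {W W' : Finset V} : IsRootedTree G u W → IsRootedTree G v W' → G.Adj u v →
      Disjoint W W' → IsRootedTree G u (W ∪ W')

namespace IsRootedTree

variable {V : Type*} [DecidableEq V] {G : SimpleGraph V}

theorem root_mem {u : V} {W : Finset V} (h : IsRootedTree G u W) : u ∈ W := by
  induction h with
  | single u => simp
  | join _ _ _ _ ih _ => exact Finset.mem_union_left _ ih

theorem reachable {u : V} {W : Finset V} (h : IsRootedTree G u W) :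
    ∀ x ∈ W, G.Reachable u x := by
  induction h with
  | single u => simp
  | join _ _ hadj _ ih ih' =>
    intro x hx
    rcases Finset.mem_union.1 hx with hx | hx
    · exact ih x hx
    · exact hadj.reachable.trans (ih' x hx)

/-- The leaf is pushed down into the subtree that contains its neighbour, until this subtree is a
single vertex. -/
theorem insert_leaf {u : V} {W : Finset V} (h : IsRootedTree G u W) {w x : V} (hw : w ∈ W)
    (hadj : G.Adj w x) (hx : x ∉ W) : IsRootedTree G u (insert x W) := by
  induction h with
  | single u =>
    obtain rfl := Finset.mem_singleton.1 hw
    rw [Finset.insert_eq, Finset.union_comm]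
    exact join (single _) (single _) hadj (by simpa [eq_comm] using hx)
  | @join u v W W' h h' huv hdis ih ih' =>
    rw [Finset.mem_union, not_or] at hx
    rcases Finset.mem_union.1 hw with hw | hw
    · rw [← Finset.insert_union]
      exact join (ih hw hx.1) h' huv (by simp [hx.2, hdis])
    · rw [← Finset.union_insert]
      exact join h (ih' hw hx.2) huv (by simp [hx.1, hdis])

/-- A tree can grow by a leaf unless its vertex set is closed under adjacency; a closed set
containing `u` contains `R` and is too large. The exact size matters because all adapters of a chain
need the same length. -/
theorem exists_card_eq (u : V) {R : Finset V} (hR : ∀ x ∈ R, G.Reachable u x) {n : ℕ}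
    (hn : 0 < n) (hnR : n ≤ R.card) : ∃ W, IsRootedTree G u W ∧ W.card = n := by
  induction n, hn using Nat.le_induction with
  | base => exact ⟨{u}, single u, by simp⟩
  | succ n hn ih =>
    obtain ⟨W, hW, hcard⟩ := ih (by omega)
    have : ∃ w ∈ W, ∃ x, G.Adj w x ∧ x ∉ W := by
      by_contra! hcl
      have hall : ∀ x, G.Reachable u x → x ∈ W := by
        rintro x ⟨p⟩
        have : ∀ {a b : V} (_ : G.Walk a b), a ∈ W → b ∈ W := by
          intro a b p
          induction p with
          | nil => exact id
          | cons h _ ih => exact fun ha => ih (hcl _ ha _ h)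
        exact this p hW.root_mem
      have := Finset.card_le_card fun x hx => hall x (hR x hx)
      omega
    obtain ⟨w, hw, x, hadj, hx⟩ := this
    exact ⟨insert x W, hW.insert_leaf hw hadj hx, by rw [Finset.card_insert_of_notMem hx, hcard]⟩

end IsRootedTree

section SkipTree

variable {V : Type*} [Fintype V]

/-- The boundary of an edge set consists of two given vertices (it is empty if they are equal). -/
def HasBoundary (T : Finset (Sym2 V)) (a b : V) : Prop :=
  ∀ w : V → ZMod 2, ∑ e ∈ T, coboundary w e = w a + w b

/-- A sequence of vertices, each with an edge set whose boundary is this vertex and the next one;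
the last edge set leads to `b`. -/
inductive IsHopSequence : V → V → List (V × Finset (Sym2 V)) → Prop
  | nil (a : V) : IsHopSequence a a []
  | cons {a b c : V} {T : Finset (Sym2 V)} {l : List (V × Finset (Sym2 V))} :
      HasBoundary T a b → IsHopSequence b c l → IsHopSequence a c ((a, T) :: l)

theorem IsHopSequence.append {a b c : V} {l l' : List (V × Finset (Sym2 V))}
    (h : IsHopSequence a b l) (h' : IsHopSequence b c l') : IsHopSequence a c (l ++ l') := by
  induction h with
  | nil => exact h'
  | cons hT _ ih => exact .cons hT (ih h')

theorem IsHopSequence.hasBoundary {a b : V} {l : List (V × Finset (Sym2 V))}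
    (h : IsHopSequence a b l) (k : ℕ) (hk : k < l.length) :
    HasBoundary l[k].2 l[k].1 (if hk' : k + 1 < l.length then l[k + 1].1 else b) := by
  induction h generalizing k with
  | nil => simp at hk
  | @cons a b c T l hT h ih =>
    cases k with
    | zero =>
      cases h with
      | nil => simpa using hT
      | cons => simpa using hT
    | succ k => simpa using ih k (by simpa using hk)

variable [DecidableEq V]

/-- The edge between two vertices, if they are distinct. -/
def closingEdge (p q : V) : Finset (Sym2 V) := if p = q then ∅ else {s(p, q)}

theorem closingEdge_comm {V : Type*} [DecidableEq V] (p q : V) : closingEdge p q = closingEdge q p := by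
  simp [closingEdge, Sym2.eq_swap, eq_comm]

theorem hasBoundary_closingEdge (p q : V) : HasBoundary (closingEdge p q) p q := by
  intro w
  by_cases h : p = q
  · subst h
    simp [closingEdge, CharTwo.add_self_eq_zero]
  · simp [closingEdge, h, coboundary_mk]

theorem card_closingEdge_le {V : Type*} [DecidableEq V] (p q : V) : (closingEdge p q).card ≤ 1 := by
  unfold closingEdge
  split_ifs <;> simp

/-- A Hamiltonian sequence of the vertices in `W` from `p` to `q`, where consecutive vertices are
joined by at most three edges and every edge is used at most twice, counting the edge from `q`
back to `p`. -/
def HasSkipTour (G : SimpleGraph V) (W : Finset V) (p q : V) : Prop :=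
  p ∈ W ∧ q ∈ W ∧ (p = q ∨ G.Adj p q) ∧ ∃ l : List (V × Finset (Sym2 V)),
    IsHopSequence p q l ∧ (l.map Prod.fst ++ [q]).Nodup ∧
    (∀ x, x ∈ l.map Prod.fst ++ [q] ↔ x ∈ W) ∧
    (∀ T ∈ l.map Prod.snd, T.card ≤ 3 ∧ ∀ e ∈ T, e ∈ G.edgeSet ∧ ∀ x ∈ e, x ∈ W) ∧
    ∀ e, (l.map fun T => if e ∈ T.2 then 1 else 0).sum +
      (if e ∈ closingEdge p q then 1 else 0) ≤ 2

theorem HasSkipTour.singleton (G : SimpleGraph V) (u : V) : HasSkipTour G {u} u u :=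
  ⟨by simp, by simp, .inl rfl, [], .nil u, by simp [closingEdge]⟩

theorem mem_closingEdge_inside {V : Type*} [DecidableEq V] {G : SimpleGraph V} {W : Finset V} {p q : V} (hp : p ∈ W)
    (hq : q ∈ W) (h : p = q ∨ G.Adj p q) {e : Sym2 V} (he : e ∈ closingEdge p q) :
    e ∈ G.edgeSet ∧ ∀ x ∈ e, x ∈ W := by
  by_cases hpq : p = q
  · simp [closingEdge, hpq] at he
  · simp only [closingEdge, hpq, if_false, Finset.mem_singleton] at he
    subst he
    refine ⟨h.resolve_left hpq, fun x hx => ?_⟩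
    rcases Sym2.mem_iff.1 hx with rfl | rfl <;> assumption

/-- The SkipTree recursion: traverse the first tree from `u` to `u'`, hop along `u'`, `u`, `v`,
`v'`, and traverse the second tree from `v'` to `v`. The hop consists of the closing edges of the
two tours and the joining edge, so it has length at most three. -/
theorem HasSkipTour.join {G : SimpleGraph V} {W W' : Finset V} {u u' v v' : V}
    (h : HasSkipTour G W u u') (h' : HasSkipTour G W' v' v) (huv : G.Adj u v)
    (hdis : Disjoint W W') : HasSkipTour G (W ∪ W') u v := by
  obtain ⟨hu, hu', hadj, l, hl, hnd, hmem, hT, hcount⟩ := h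
  obtain ⟨hv', hv, hadj', l', hl', hnd', hmem', hT', hcount'⟩ := h'
  have hd : ∀ x, x ∈ W → x ∈ W' → False := fun x h1 h2 => Finset.disjoint_left.1 hdis h1 h2
  have hne : ∀ e : Sym2 V, ∃ x, x ∈ e := fun e => by
    induction e with | _ a b
    exact ⟨a, by simp⟩
  set mid := closingEdge u u' ∪ ({s(u, v)} ∪ closingEdge v' v) with hmid
  have hin : ∀ e ∈ closingEdge u u', e ∈ G.edgeSet ∧ ∀ x ∈ e, x ∈ W :=
    fun e he => mem_closingEdge_inside hu hu' hadj he
  have hin' : ∀ e ∈ closingEdge v' v, e ∈ G.edgeSet ∧ ∀ x ∈ e, x ∈ W' :=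
    fun e he => mem_closingEdge_inside hv' hv hadj' he
  have d2 : Disjoint {s(u, v)} (closingEdge v' v) := by
    rw [Finset.disjoint_singleton_left]
    exact fun he => hd u hu ((hin' _ he).2 u (by simp))
  have d1 : Disjoint (closingEdge u u') ({s(u, v)} ∪ closingEdge v' v) := by
    rw [Finset.disjoint_union_right, Finset.disjoint_singleton_right]
    refine ⟨fun he => hd v ((hin _ he).2 v (by simp)) hv, Finset.disjoint_left.2 fun e he he' => ?_⟩
    obtain ⟨x, hx⟩ := hne e
    exact hd x ((hin e he).2 x hx) ((hin' e he').2 x hx)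
  have hb : HasBoundary mid u' v' := fun w => by
    rw [hmid, Finset.sum_union d1, Finset.sum_union d2, hasBoundary_closingEdge,
      hasBoundary_closingEdge, Finset.sum_singleton, coboundary_mk w huv.ne]
    have h2 : (2 : ZMod 2) = 0 := rfl
    linear_combination (w u + w v) * h2
  refine ⟨by simp [hu], by simp [hv], .inr huv, l ++ (u', mid) :: l', hl.append (.cons hb hl'),
    ?_, ?_, ?_, ?_⟩
  · have : (l ++ (u', mid) :: l').map Prod.fst ++ [v] =
        (l.map Prod.fst ++ [u']) ++ (l'.map Prod.fst ++ [v]) := by simp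
    rw [this, List.nodup_append]
    refine ⟨hnd, hnd', fun x hx y hy hxy => ?_⟩
    subst hxy
    exact hd x ((hmem x).1 hx) ((hmem' x).1 hy)
  · intro x
    have : (l ++ (u', mid) :: l').map Prod.fst ++ [v] =
        (l.map Prod.fst ++ [u']) ++ (l'.map Prod.fst ++ [v]) := by simp
    rw [this, List.mem_append, hmem, hmem', Finset.mem_union]
  · intro T hTm
    rw [List.map_append, List.map_cons, List.mem_append, List.mem_cons] at hTm
    rcases hTm with h1 | rfl | h1
    · exact ⟨(hT T h1).1, fun e he => ⟨((hT T h1).2 e he).1,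
        fun x hx => Finset.mem_union_left _ (((hT T h1).2 e he).2 x hx)⟩⟩
    · constructor
      · have c1 := Finset.card_union_le (closingEdge u u') ({s(u, v)} ∪ closingEdge v' v)
        have c2 := Finset.card_union_le {s(u, v)} (closingEdge v' v)
        have c3 := card_closingEdge_le u u'
        have c4 := card_closingEdge_le v' v
        rw [Finset.card_singleton] at c2
        rw [← hmid] at c1
        change mid.card ≤ 3
        omega
      · intro e he
        rw [hmid, Finset.mem_union, Finset.mem_union, Finset.mem_singleton] at he
        rcases he with he | rfl | he
        · exact ⟨(hin e he).1, fun x hx => Finset.mem_union_left _ ((hin e he).2 x hx)⟩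
        · refine ⟨huv, fun x hx => ?_⟩
          rcases Sym2.mem_iff.1 hx with rfl | rfl
          · exact Finset.mem_union_left _ hu
          · exact Finset.mem_union_right _ hv
        · exact ⟨(hin' e he).1, fun x hx => Finset.mem_union_right _ ((hin' e he).2 x hx)⟩
    · exact ⟨(hT' T h1).1, fun e he => ⟨((hT' T h1).2 e he).1,
        fun x hx => Finset.mem_union_right _ (((hT' T h1).2 e he).2 x hx)⟩⟩
  · intro e
    have hz : (∃ x ∈ e, x ∉ W) → (l.map fun T => if e ∈ T.2 then 1 else 0).sum = 0 := by
      rintro ⟨x, hx, hxW⟩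
      refine List.sum_eq_zero fun n hn => ?_
      obtain ⟨T, hTl, rfl⟩ := List.mem_map.1 hn
      exact if_neg fun he => hxW (((hT T.2 (List.mem_map_of_mem hTl)).2 e he).2 x hx)
    have hz' : (∃ x ∈ e, x ∉ W') → (l'.map fun T => if e ∈ T.2 then 1 else 0).sum = 0 := by
      rintro ⟨x, hx, hxW⟩
      refine List.sum_eq_zero fun n hn => ?_
      obtain ⟨T, hTl, rfl⟩ := List.mem_map.1 hn
      exact if_neg fun he => hxW (((hT' T.2 (List.mem_map_of_mem hTl)).2 e he).2 x hx)
    have hclose : closingEdge u v = {s(u, v)} := by simp [closingEdge, huv.ne]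
    rw [List.map_append, List.map_cons, List.sum_append, List.sum_cons, hclose]
    have h1 := hcount e
    have h2 := hcount' e
    -- The joining edge is used once in the hop and once as the new closing edge. Any other edge in
    -- the hop is an old closing edge, whose use the counts of the two tours already reserve.
    by_cases he : e = s(u, v)
    · rw [hz ⟨v, by simp [he], fun h => hd v h hv⟩, hz' ⟨u, by simp [he], hd u hu⟩]
      simp [he, hmid]
    · have hmem_mid : e ∈ mid ↔ e ∈ closingEdge u u' ∨ e ∈ closingEdge v' v := by
        simp [hmid, he]
      simp only [hmem_mid, Finset.mem_singleton, he, if_false]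
      obtain ⟨x, hx⟩ := hne e
      by_cases hxW : x ∈ W
      · have hn : e ∉ closingEdge v' v := fun h => hd x hxW ((hin' e h).2 x hx)
        rw [hz' ⟨x, hx, hd x hxW⟩]
        simp only [hn, or_false]
        omega
      · have hn : e ∉ closingEdge u u' := fun h => hxW ((hin e h).2 x hx)
        rw [hz ⟨x, hx, hxW⟩]
        simp only [hn, false_or]
        omega

/-- Joining takes a tour that starts at one root and a tour that ends at the other. The induction
therefore carries both kinds, and the two orders of joining reproduce both. -/
theorem IsRootedTree.exists_hasSkipTour {G : SimpleGraph V} {u : V} {W : Finset V}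
    (h : IsRootedTree G u W) :
    (∃ u', HasSkipTour G W u u') ∧ ∃ u', HasSkipTour G W u' u := by
  induction h with
  | single u => exact ⟨⟨u, .singleton G u⟩, ⟨u, .singleton G u⟩⟩
  | @join u v W W' _ _ huv hdis ih ih' =>
    obtain ⟨⟨u₁, h₁⟩, ⟨u₂, h₂⟩⟩ := ih
    obtain ⟨⟨v₁, h₁'⟩, ⟨v₂, h₂'⟩⟩ := ih'
    exact ⟨⟨v, h₁.join h₂' huv hdis⟩, ⟨v, Finset.union_comm W W' ▸ h₁'.join h₂ huv.symm hdis.symm⟩⟩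

theorem HasSkipTour.exists_isSkipTreeOrder {G : SimpleGraph V} {W : Finset V} {p q : V}
    (h : HasSkipTour G W p q) :
    ∃ ℓ : Fin W.card → V, IsSkipTreeOrder G ℓ ∧ ∀ k, ℓ k ∈ W := by
  classical
  obtain ⟨hp, hq, hadj, l, hl, hnd, hmem, hT, hcount⟩ := h
  -- The last hop from `q` back to `p` makes the sequence cyclic; its edge is already included in
  -- the count of a tour.
  set m := l ++ [(q, closingEdge p q)] with hm
  have hmap : m.map Prod.fst = l.map Prod.fst ++ [q] := by simp [hm]
  have hlen : W.card = m.length := by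
    have : W = (m.map Prod.fst).toFinset := by ext x; rw [hmap, List.mem_toFinset, hmem]
    rw [this, List.toFinset_card_of_nodup (hmap ▸ hnd), List.length_map]
  have hseq : IsHopSequence p p m :=
    hl.append (.cons (by rw [closingEdge_comm]; exact hasBoundary_closingEdge q p) (.nil p))
  have hzero : ∀ h0 : 0 < m.length, m[0].1 = p := by
    intro h0
    generalize m = m' at hseq h0
    cases hseq with
    | nil => simp at h0
    | cons => rfl
  rw [hlen]
  have hmemW : ∀ x, x ∈ W ↔ ∃ k : Fin m.length, m[k].1 = x := by
    intro x
    rw [← hmem, ← hmap, List.mem_map]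
    constructor
    · rintro ⟨y, hy, rfl⟩
      obtain ⟨k, hk, rfl⟩ := List.getElem_of_mem hy
      exact ⟨⟨k, hk⟩, rfl⟩
    · rintro ⟨k, rfl⟩
      exact ⟨_, List.getElem_mem k.2, rfl⟩
  have hTm : ∀ k : Fin m.length, m[k].2.card ≤ 3 ∧
      ∀ e ∈ m[k].2, e ∈ G.edgeSet ∧ ∀ x ∈ e, x ∈ W := by
    intro k
    have hk : m[k] ∈ m := List.getElem_mem k.2
    generalize m[k] = y at hk
    rw [hm, List.mem_append, List.mem_singleton] at hk
    rcases hk with hk | rfl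
    · exact hT y.2 (List.mem_map_of_mem hk)
    · exact ⟨(card_closingEdge_le p q).trans (by norm_num),
        fun e he => mem_closingEdge_inside hp hq hadj he⟩
  refine ⟨fun k => m[k].1, ⟨?_, fun k => m[k].2, ?_, fun k => (hTm k).1, ?_, ?_⟩,
    fun k => (hmemW _).2 ⟨k, rfl⟩⟩
  · intro i j hij
    have h1 : (m.map Prod.fst).Nodup := hmap ▸ hnd
    have := (h1.getElem_inj_iff (i := i.1) (hi := by simp) (j := j.1) (hj := by simp)).1
      (by simpa using hij)
    exact Fin.ext this
  · exact fun k e he => ⟨((hTm k).2 e he).1, fun x hx => (hmemW x).1 (((hTm k).2 e he).2 x hx)⟩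
  · intro e
    rw [Finset.card_filter]
    have h1 := Fin.sum_univ_fun_getElem m (fun T => if e ∈ T.2 then 1 else 0)
    refine le_trans (le_of_eq (Eq.trans (by congr!) h1)) ?_
    have := hcount e
    simpa [hm] using this
  · intro k x
    have h1 := hseq.hasBoundary k.1 k.2 (Pi.single x 1)
    rw [sum_coboundary, Finset.sum_eq_single x] at h1
    · simp only [Pi.single_eq_same, mul_one] at h1
      refine Eq.trans (by congr!) (h1.trans ?_)
      -- The last index rotates to 0, where the sequence starts at `p`.
      have h2 : (if hk' : k.1 + 1 < m.length then m[k.1 + 1].1 else p) =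
          m[finRotate m.length k].1 := by
        obtain ⟨n, hn⟩ : ∃ n, m.length = n + 1 := ⟨l.length, by simp [hm]⟩
        have hrot : (finRotate m.length k).1 = if k.1 + 1 < m.length then k.1 + 1 else 0 := by
          clear * - hn
          generalize m.length = N at *
          subst hn
          rw [coe_finRotate]
          have := k.2
          simp only [Fin.ext_iff, Fin.val_last]
          split_ifs <;> omega
        split_ifs with h
        · simp only [Fin.getElem_fin, hrot, h, if_true]
        · simp only [Fin.getElem_fin, hrot, h, if_false]
          exact (hzero _).symm
      have h3 : ∀ y : V, (Pi.single x 1 : V → ZMod 2) y = if x = y then 1 else 0 := fun y => by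
        rw [Pi.single_apply]
        exact if_congr eq_comm rfl rfl
      rw [h2, h3, h3]
      congr!
    · intro y _ hy
      simp [hy]
    · simp

end SkipTree
end

noncomputable section

/-! ### Extending an auxiliary graph by the matched pairs -/

theorem IsSkipTreeOrder.mono {V : Type*} {G G' : SimpleGraph V} (hG : G ≤ G') {a : ℕ}
    {ℓ : Fin a → V} (h : IsSkipTreeOrder G ℓ) : IsSkipTreeOrder G' ℓ := by
  obtain ⟨hinj, T, h1, h2, h3, h4⟩ := h
  exact ⟨hinj, T, fun k e he => ⟨SimpleGraph.edgeSet_mono hG (h1 k e he).1, (h1 k e he).2⟩,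
    h2, h3, h4⟩

theorem sum_matched_pairs {V M : Type*} [AddCommMonoid M] {T : Finset V} {k : ℕ} {a b : Fin k → V}
    (hinj : Function.Injective (Sum.elim a b)) (hT : ∀ x, x ∈ T ↔ ∃ j, a j = x ∨ b j = x)
    (w : V → M) : ∑ x ∈ T, w x = ∑ j, (w (a j) + w (b j)) := by
  classical
  have h2 : T = Finset.univ.image (Sum.elim a b) := by
    ext x; simp [hT, exists_or]
  rw [h2, Finset.sum_image fun x _ y _ h => hinj h, Fintype.sum_sum_type,
    ← Finset.sum_add_distrib]
  rfl

/-- A vertex occurs in at most one pair. Hence each check contributes at most one new edge at a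
vertex and at most one pair across a given edge. -/
theorem eq_of_matched {V : Type*} {k : ℕ} {a b : Fin k → V}
    (hinj : Function.Injective (Sum.elim a b)) {j j' : Fin k} {x y y' : V}
    (h : (a j = x ∧ b j = y) ∨ (a j = y ∧ b j = x))
    (h' : (a j' = x ∧ b j' = y') ∨ (a j' = y' ∧ b j' = x)) : j = j' ∧ y = y' := by
  have ha : ∀ i i', a i = a i' → i = i' := fun i i' h => by
    simpa using hinj (a₁ := .inl i) (a₂ := .inl i') h
  have hb : ∀ i i', b i = b i' → i = i' := fun i i' h => by
    simpa using hinj (a₁ := .inr i) (a₂ := .inr i') h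
  have hab : ∀ i i', a i ≠ b i' := fun i i' h => by
    simpa using hinj (a₁ := .inl i) (a₂ := .inr i') h
  rcases h with ⟨h1, h2⟩ | ⟨h1, h2⟩ <;> rcases h' with ⟨h3, h4⟩ | ⟨h3, h4⟩
  · obtain rfl := ha _ _ (h1.trans h3.symm)
    exact ⟨rfl, h2.symm.trans h4⟩
  · exact (hab _ _ (h1.trans h4.symm)).elim
  · exact (hab _ _ (h3.trans h2.symm)).elim
  · obtain rfl := hb _ _ (h2.trans h4.symm)
    exact ⟨rfl, h1.symm.trans h3⟩

namespace AuxGraph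

variable {Q S V : Type*} [Fintype Q] [Fintype S] [Fintype V] {A : AuxGraph Q S V}
  {check : S → Pauli Q} {d : ℕ} {K : DesiderataBounds}

-- A vertex is attached to at most one qubit, and at most `β` checks act on that qubit.
open Classical in
theorem SatisfiesDesiderata.card_checks_at_le {L : Finset Q}
    (hA : A.SatisfiesDesiderata check L d K) {α β : ℕ} (h : IsLDPC check α β) (x : V) :
    (Finset.univ.filter fun s => x ∈ A.portOf (check s).xSupport).card ≤ β := by
  by_cases hx : ∃ q, x ∈ A.port q
  · obtain ⟨q, hq⟩ := hx
    refine le_trans (Finset.card_le_card fun s hs => ?_) (h.2 q)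
    rw [Finset.mem_filter, portOf, Finset.mem_biUnion] at hs
    obtain ⟨-, q', hq', hxq'⟩ := hs
    have : q' = q := by
      by_contra hne
      exact Finset.disjoint_left.1 (hA.port_disjoint q' q hne) hxq' hq
    subst this
    rw [Finset.mem_filter, Pauli.mem_support]
    exact ⟨Finset.mem_univ _, .inl (Pauli.mem_xSupport.1 hq')⟩
  · rw [Finset.filter_false_of_mem, Finset.card_empty]
    · exact Nat.zero_le _
    · intro s _ hs
      rw [portOf, Finset.mem_biUnion] at hs
      obtain ⟨q, -, hq⟩ := hs
      exact hx ⟨q, hq⟩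

/-- A graph whose components separate the port of every check into even parts has a component with
at least `d` port vertices. -/
theorem SatisfiesDesiderata.exists_large_component {Z : Pauli Q}
    (hA : A.SatisfiesDesiderata check Z.support d K) (hZ : Z.IsZType)
    (hnt : Z ∉ stabilizerGroup check) (hd : (d : ℕ∞) ≤ codeDistance check) (N : SimpleGraph V)
    (hN : ∀ s, ∀ w : V → ZMod 2, (∀ x y, N.Adj x y → w x = w y) →
      ∑ x ∈ A.portOf (check s).xSupport, w x = 0) :
    ∃ R : Finset V, R ⊆ A.portOf Finset.univ ∧ d ≤ R.card ∧ ∀ x ∈ R, ∀ y ∈ R, N.Reachable x y := by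
  classical
  -- The indicators of the components sum to 1, so their Z-type operators multiply to `Z`. By `hN`
  -- each is logical, and one of them must be nontrivial.
  let w : N.ConnectedComponent → V → ZMod 2 := fun κ x =>
    if N.connectedComponentMk x = κ then 1 else 0
  have hsum : ∑ κ, A.portZ (w κ) = Z := by
    rw [← portZ_one_of_parity hZ hA.port_parity]
    simp only [← restrict_vertexOp, ← map_sum]
    congr 1
    simp only [vertexOp]
    rw [Finset.sum_comm]
    refine Finset.sum_congr rfl fun x _ => ?_
    rw [← Finset.sum_smul]
    simp [w]
  obtain ⟨κ, hκ⟩ : ∃ κ, A.portZ (w κ) ∉ stabilizerGroup check := by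
    by_contra! h
    exact hnt (hsum ▸ Submodule.sum_mem _ fun κ _ => h κ)
  have hlog : IsNontrivialLogical check (A.portZ (w κ)) := by
    refine ⟨fun s => ?_, hκ⟩
    rw [symp_portZ _ _ _ hA.port_disjoint]
    refine hN s _ fun x y hxy => ?_
    simp only [w]
    rw [SimpleGraph.ConnectedComponent.sound hxy.reachable]
  have h1 : d ≤ (A.portZ (w κ)).weight := by
    simpa using hd.trans (iInf₂_le _ hlog)
  refine ⟨(A.portOf Finset.univ).filter fun x => w κ x ≠ 0, Finset.filter_subset _ _,
    h1.trans (weight_portZ_le hA.port_disjoint _), fun x hx y hy => ?_⟩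
  have hx' : N.connectedComponentMk x = κ := by
    by_contra h
    exact (Finset.mem_filter.1 hx).2 (if_neg h)
  have hy' : N.connectedComponentMk y = κ := by
    by_contra h
    exact (Finset.mem_filter.1 hy).2 (if_neg h)
  exact SimpleGraph.ConnectedComponent.exact (hx'.trans hy'.symm)

open Classical in
/-- An auxiliary graph can be extended by edges between matched vertices to a graph with a bounded
cycle basis that has `d` port vertices in SkipTree order. -/
theorem SatisfiesDesiderata.exists_extension {Z : Pauli Q}
    (hA : A.SatisfiesDesiderata check Z.support d K) (hZ : Z.IsZType) {α β : ℕ}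
    (hL : IsLDPC check α β) (hnt : Z ∉ stabilizerGroup check)
    (hd : (d : ℕ∞) ≤ codeDistance check) (hd0 : 0 < d) :
    ∃ (G : SimpleGraph V) (C : Finset (Finset (Sym2 V))) (ℓ : Fin d → V),
      A.graph ≤ G ∧
      (∀ x y, G.Adj x y → A.graph.Adj x y ∨
        ∃ s, x ∈ A.portOf (check s).xSupport ∧ y ∈ A.portOf (check s).xSupport) ∧
      IsCycleBasis G C ∧ IsSkipTreeOrder G ℓ ∧ (∀ k, ℓ k ∈ A.portOf Finset.univ) ∧
      (∀ x, (Finset.univ.filter fun y => G.Adj x y).card ≤ K.degree + β) ∧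
      (∀ c ∈ C, c.card ≤ K.cycleLength + (K.matchSize + 1)) ∧
      ∀ e, (C.filter fun c => e ∈ c).card ≤ K.cycleOverlap + (K.matchOverlap + β) := by
  choose n a b p hp hinj hT hdis hμ using hA.isPathMatching
  have hport : ∀ s, A.portOf (check s).xSupport ⊆ A.portOf Finset.univ := fun s =>
    Finset.biUnion_subset_biUnion_of_subset_left _ (Finset.subset_univ _)
  -- The graph of matched pairs. A potential constant on its components sums to zero over the port
  -- of each check, as the two vertices of a pair cancel.
  let N : SimpleGraph V :=
    { Adj := fun x y => x ≠ y ∧ ∃ s j, (a s j = x ∧ b s j = y) ∨ (a s j = y ∧ b s j = x)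
      symm := ⟨fun x y ⟨h, s, j, h'⟩ => ⟨h.symm, s, j, h'.symm⟩⟩
      loopless := ⟨fun x h => h.1 rfl⟩ }
  have hab : ∀ s j, a s j ≠ b s j := fun s j h => by
    simpa using hinj s (a₁ := .inl j) (a₂ := .inr j) h
  have hNab : ∀ s j, N.Adj (a s j) (b s j) := fun s j => ⟨hab s j, s, j, .inl ⟨rfl, rfl⟩⟩
  have hNport : ∀ x y s j, (a s j = x ∧ b s j = y) ∨ (a s j = y ∧ b s j = x) →
      x ∈ A.portOf (check s).xSupport ∧ y ∈ A.portOf (check s).xSupport := by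
    rintro x y s j (⟨rfl, rfl⟩ | ⟨rfl, rfl⟩) <;>
      exact ⟨(hT s _).2 ⟨j, by simp⟩, (hT s _).2 ⟨j, by simp⟩⟩
  obtain ⟨R, hRU, hRd, hR⟩ := hA.exists_large_component hZ hnt hd N fun s w hw => by
    rw [sum_matched_pairs (hinj s) (hT s)]
    exact Finset.sum_eq_zero fun j _ => by
      rw [hw _ _ (hNab s j), CharTwo.add_self_eq_zero]
  obtain ⟨u, hu⟩ : R.Nonempty := Finset.card_pos.1 (by omega)
  obtain ⟨W, hW, hWd⟩ := IsRootedTree.exists_card_eq u (hR u hu) hd0 hRd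
  -- The tree may leave `R`, but the root is a port vertex, and so is every vertex with an
  -- `N`-neighbour.
  have hWU : ∀ x ∈ W, x ∈ A.portOf Finset.univ := by
    intro x hx
    obtain ⟨q⟩ := (hW.reachable x hx).symm
    cases q with
    | nil => exact hRU hu
    | cons h _ =>
      obtain ⟨-, s, j, h⟩ := h
      exact hport s (hNport _ _ s j h).1
  obtain ⟨⟨u', htour⟩, -⟩ := hW.exists_hasSkipTour
  obtain ⟨ℓ, hℓ, hℓW⟩ := htour.exists_isSkipTreeOrder
  subst hWd
  let I := Σ s, Fin (n s)
  let pe : I → Finset (Sym2 V) := fun i => (p i.1 i.2).edges.toFinset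
  let cyc : I → Finset (Sym2 V) := fun i => insert s(a i.1 i.2, b i.1 i.2) (pe i)
  -- Only pairs not yet adjacent give new edges. For these the new edge is not on the matching path,
  -- so adding it closes the path to a cycle.
  let J : Finset I := Finset.univ.filter fun i => ¬ A.graph.Adj (a i.1 i.2) (b i.1 i.2)
  have hpe : ∀ i, ∀ e ∈ pe i, e ∈ A.graph.edgeSet := fun i e he =>
    (p i.1 i.2).edges_subset_edgeSet (List.mem_toFinset.1 he)
  have hpeμ : ∀ i, pe i ⊆ A.matching i.1 := fun i e he =>
    (hμ i.1 e).2 ⟨i.2, List.mem_toFinset.1 he⟩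
  have hJ : ∀ i ∈ J, s(a i.1 i.2, b i.1 i.2) ∉ pe i := fun i hi he =>
    (Finset.mem_filter.1 hi).2 (hpe i _ he)
  have hpesum : ∀ i w, ∑ e ∈ pe i, coboundary w e = w (a i.1 i.2) + w (b i.1 i.2) := fun i w =>
    (hp i.1 i.2).sum_coboundary w
  refine ⟨A.graph ⊔ N, A.cycles ∪ J.image cyc, ℓ, le_sup_left, ?_, ?_, hℓ.mono le_sup_right,
    fun k => hWU _ (hℓW k), ?_, ?_, ?_⟩
  · rintro x y (h | ⟨-, s, j, h⟩)
    · exact .inl h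
    · exact .inr ⟨s, hNport x y s j h⟩
  · apply isCycleBasis_of_forall_exists
    · intro c hc e he
      rcases Finset.mem_union.1 hc with hc | hc
      · exact SimpleGraph.edgeSet_mono le_sup_left (hA.isCycleBasis.1 c hc e he)
      · obtain ⟨i, hi, rfl⟩ := Finset.mem_image.1 hc
        rcases Finset.mem_insert.1 he with rfl | he
        · exact SimpleGraph.edgeSet_mono le_sup_right (hNab i.1 i.2)
        · exact SimpleGraph.edgeSet_mono le_sup_left (hpe i e he)
    · intro c hc
      rcases Finset.mem_union.1 hc with hc | hc
      · exact hA.isCycleBasis.isEvenEdgeSet hc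
      · obtain ⟨i, hi, rfl⟩ := Finset.mem_image.1 hc
        refine isEvenEdgeSet_of_sum_coboundary fun w => ?_
        rw [Finset.sum_insert (hJ i hi), hpesum, coboundary_mk w (hab _ _),
          CharTwo.add_self_eq_zero]
    -- A potential for the old graph also works for the new edges: the cycle through a new edge
    -- determines `y` on it from the path.
    · intro y hy
      obtain ⟨w, hw⟩ := hA.isCycleBasis.exists_coboundary y
        fun c hc => hy c (Finset.mem_union_left _ hc)
      refine ⟨w, fun e he => ?_⟩
      by_cases heA : e ∈ A.graph.edgeSet
      · exact hw e heA
      · have : ∃ i : I, e = s(a i.1 i.2, b i.1 i.2) := by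
          induction e with | _ x x'
          obtain ⟨-, s, j, h⟩ := (he : A.graph.Adj x x' ∨ N.Adj x x').resolve_left heA
          refine ⟨⟨s, j⟩, ?_⟩
          rcases h with ⟨rfl, rfl⟩ | ⟨rfl, rfl⟩
          · rfl
          · exact Sym2.eq_swap
        obtain ⟨i, rfl⟩ := this
        have hi : i ∈ J := Finset.mem_filter.2 ⟨Finset.mem_univ _, heA⟩
        have h1 := hy (cyc i) (Finset.mem_union_right _ (Finset.mem_image_of_mem _ hi))
        rw [Finset.sum_insert (hJ i hi), Finset.sum_congr rfl fun e he => hw e (hpe i e he),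
          hpesum] at h1
        rw [coboundary_mk w (hab _ _)]
        exact CharTwo.add_eq_zero.1 h1
  · intro x
    have h1 : (Finset.univ.filter fun y => N.Adj x y).card ≤ β := by
      refine le_trans ?_ (hA.card_checks_at_le hL x)
      -- Each new neighbour is charged to a check that acts at `x`, and distinct neighbours to
      -- distinct checks.
      choose σ hσ using fun y : {y // N.Adj x y} => y.2.2
      rw [← Fintype.card_subtype, ← Finset.card_univ]
      refine Finset.card_le_card_of_injOn σ (fun y _ => ?_) fun y _ y' _ h => ?_
      · obtain ⟨j, hj⟩ := hσ y
        simpa using (hNport x y _ _ hj).1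
      · obtain ⟨j, hj⟩ := hσ y
        obtain ⟨j', hj'⟩ := hσ y'
        generalize σ y = s at h j hj
        subst h
        exact Subtype.ext (eq_of_matched (hinj _) hj hj').2
    refine le_trans ?_ (Nat.add_le_add (hA.degree_le x) h1)
    refine (Finset.card_le_card fun y hy => ?_).trans (Finset.card_union_le _ _)
    simpa using hy
  · intro c hc
    rcases Finset.mem_union.1 hc with hc | hc
    · have := hA.cycleLength_le c hc
      omega
    · obtain ⟨i, hi, rfl⟩ := Finset.mem_image.1 hc
      have h1 := Finset.card_insert_le s(a i.1 i.2, b i.1 i.2) (pe i)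
      have h2 := (Finset.card_le_card (hpeμ i)).trans (hA.matchSize_le i.1)
      have h3 : (cyc i).card ≤ (pe i).card + 1 := h1
      omega
  · intro e
    rw [Finset.filter_union]
    refine (Finset.card_union_le _ _).trans (Nat.add_le_add (hA.cycleOverlap_le e) ?_)
    rw [Finset.filter_image]
    refine Finset.card_image_le.trans ?_
    -- The paths of one matching are edge-disjoint, so a new cycle whose path contains `e` is
    -- determined by its check.
    have h1 : (J.filter fun i => e ∈ pe i).card ≤ K.matchOverlap := by
      refine le_trans (Finset.card_le_card_of_injOn Sigma.fst (fun i hi => ?_) ?_)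
        (hA.matchOverlap_le e)
      · have hi : i ∈ J ∧ e ∈ pe i := by simpa using hi
        simpa using hpeμ i hi.2
      · rintro ⟨s, j⟩ hi ⟨s', j'⟩ hi' (rfl : s = s')
        have hi : e ∈ pe ⟨s, j⟩ := (Finset.mem_filter.1 (Finset.mem_coe.1 hi)).2
        have hi' : e ∈ pe ⟨s, j'⟩ := (Finset.mem_filter.1 (Finset.mem_coe.1 hi')).2
        by_contra hne
        exact hdis s j j' (fun h => hne (h ▸ rfl)) e (List.mem_toFinset.1 hi)
          (List.mem_toFinset.1 hi')
    have h2 : (J.filter fun i => e = s(a i.1 i.2, b i.1 i.2)).card ≤ β := by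
      induction e with | _ x y
      refine le_trans (Finset.card_le_card_of_injOn Sigma.fst (fun i hi => ?_) ?_)
        (hA.card_checks_at_le hL x)
      · have hi : i ∈ J ∧ s(x, y) = s(a i.1 i.2, b i.1 i.2) := Finset.mem_filter.1 hi
        have h3 : (a i.1 i.2 = x ∧ b i.1 i.2 = y) ∨ (a i.1 i.2 = y ∧ b i.1 i.2 = x) := by
          rw [eq_comm, Sym2.eq_iff] at hi
          exact hi.2
        simpa using (hNport x y _ _ h3).1
      · rintro ⟨s, j⟩ hi ⟨s', j'⟩ hi' (rfl : s = s')
        have hi : s(x, y) = s(a s j, b s j) :=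
          (Finset.mem_filter.1 (Finset.mem_coe.1 hi)).2
        have hi' : s(x, y) = s(a s j', b s j') :=
          (Finset.mem_filter.1 (Finset.mem_coe.1 hi')).2
        rw [eq_comm, Sym2.eq_iff] at hi hi'
        rw [(eq_of_matched (hinj s) hi hi').1]
    refine le_trans (Finset.card_le_card fun i hi => ?_)
      ((Finset.card_union_le _ _).trans (Nat.add_le_add h1 h2))
    obtain ⟨hiJ, hie⟩ := Finset.mem_filter.1 hi
    rcases Finset.mem_insert.1 hie with h | h
    · exact Finset.mem_union_right _ (Finset.mem_filter.2 ⟨hiJ, h⟩)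
    · exact Finset.mem_union_left _ (Finset.mem_filter.2 ⟨hiJ, h⟩)

end AuxGraph
end

noncomputable section

/-! ### Chaining graphs with adapters -/

section Chain

variable {t : ℕ} {V : Fin t → Type*}

theorem Fin.iff_of_consecutive {R : Fin t → Prop}
    (h : ∀ i j : Fin t, (i : ℕ) + 1 = j → (R i ↔ R j)) (i j : Fin t) : R i ↔ R j := by
  have key : ∀ (n : ℕ) (hn : n < t), R ⟨n, hn⟩ ↔ R ⟨0, by omega⟩ := by
    intro n
    induction n with
    | zero => exact fun _ => Iff.rfl
    | succ n ih => exact fun hn => (h ⟨n, by omega⟩ ⟨n + 1, hn⟩ rfl).symm.trans (ih (by omega))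
  exact (key i i.2).trans (key j j.2).symm

theorem Fin.eq_of_finRotate {M : Type*} {a : ℕ} {g : Fin a → M}
    (h : ∀ k, g (finRotate a k) = g k) (k k' : Fin a) : g k = g k' := by
  obtain _ | n := a
  · exact k.elim0
  · have key : ∀ k : Fin (n + 1), g k = g 0 := fun k => by
      induction k using Fin.induction with
      | zero => rfl
      | succ i ih =>
        rw [← ih, ← h i.castSucc, finRotate_apply, Fin.coeSucc_eq_succ]
    rw [key k, key k']

theorem Sym2.map_sigmaMk_inj {i j : Fin t} {e : Sym2 (V i)} {e' : Sym2 (V j)}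
    (h : Sym2.map (Sigma.mk i) e = Sym2.map (Sigma.mk j) e') :
    (⟨i, e⟩ : Σ i, Sym2 (V i)) = ⟨j, e'⟩ := by
  have hij : i = j := by
    induction e with | _ x y
    have hx : (⟨i, x⟩ : Σ i, V i) ∈ Sym2.map (Sigma.mk j) e' := by simp [← h]
    obtain ⟨z, -, hz⟩ := Sym2.mem_map.1 hx
    exact (congrArg Sigma.fst hz).symm
  subst hij
  rw [Sym2.map.injective sigma_mk_injective h]

theorem Sym2.map_sigmaMk_eq_iff {i : Fin t} {e e' : Sym2 (V i)} :
    Sym2.map (Sigma.mk i) e = Sym2.map (Sigma.mk i) e' ↔ e = e' :=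
  (Sym2.map.injective sigma_mk_injective).eq_iff

/-- The `k`-th edge of the adapter between the `i`-th and the `j`-th graph. -/
def adapterEdge {a : ℕ} (ℓ : ∀ i, Fin a → V i) (i j : Fin t) (k : Fin a) : Sym2 (Σ i, V i) :=
  s(⟨i, ℓ i k⟩, ⟨j, ℓ j k⟩)

theorem adapterEdge_inj {a : ℕ} {ℓ : ∀ i, Fin a → V i} (hℓ : ∀ i, Function.Injective (ℓ i))
    {i j i' j' : Fin t} {k k' : Fin a} (hij : (i : ℕ) + 1 = j) (hij' : (i' : ℕ) + 1 = j')
    (h : adapterEdge ℓ i j k = adapterEdge ℓ i' j' k') : i = i' ∧ j = j' ∧ k = k' := by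
  rcases Sym2.eq_iff.1 h with ⟨h1, h2⟩ | ⟨h1, h2⟩
  · obtain rfl : i = i' := congrArg Sigma.fst h1
    obtain rfl : j = j' := congrArg Sigma.fst h2
    exact ⟨rfl, rfl, hℓ i (eq_of_heq (Sigma.mk.inj h1).2)⟩
  · have e1 : i = j' := congrArg Sigma.fst h1
    have e2 : j = i' := congrArg Sigma.fst h2
    subst e1 e2
    omega

theorem adapterEdge_ne_map {a : ℕ} (ℓ : ∀ i, Fin a → V i) {i j m : Fin t} (hij : i ≠ j)
    (k : Fin a) (e : Sym2 (V m)) : adapterEdge ℓ i j k ≠ Sym2.map (Sigma.mk m) e := by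
  intro h
  have h1 : (⟨i, ℓ i k⟩ : Σ i, V i) ∈ Sym2.map (Sigma.mk m) e := by simp [← h, adapterEdge]
  have h2 : (⟨j, ℓ j k⟩ : Σ i, V i) ∈ Sym2.map (Sigma.mk m) e := by simp [← h, adapterEdge]
  obtain ⟨z, -, hz⟩ := Sym2.mem_map.1 h1
  obtain ⟨z', -, hz'⟩ := Sym2.mem_map.1 h2
  exact hij ((congrArg Sigma.fst hz).symm.trans (congrArg Sigma.fst hz'))

/-- Graphs in a row, where consecutive graphs are connected by an adapter. -/
def chainGraph (H : ∀ i, SimpleGraph (V i)) {a : ℕ} (ℓ : ∀ i, Fin a → V i) :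
    SimpleGraph (Σ i, V i) where
  Adj x y := (∃ i u v, x = ⟨i, u⟩ ∧ y = ⟨i, v⟩ ∧ (H i).Adj u v) ∨
    ((x.1 : ℕ) + 1 = y.1 ∨ (y.1 : ℕ) + 1 = x.1) ∧ ∃ k, ℓ x.1 k = x.2 ∧ ℓ y.1 k = y.2
  symm := ⟨by
    rintro x y (⟨i, u, v, rfl, rfl, h⟩ | ⟨h, k, h1, h2⟩)
    · exact .inl ⟨i, v, u, rfl, rfl, h.symm⟩
    · exact .inr ⟨h.symm, k, h2, h1⟩⟩
  loopless := ⟨by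
    rintro ⟨j, x⟩ (⟨i, u, v, h1, h2, h⟩ | ⟨h, -⟩)
    · rw [h1] at h2
      exact h.ne (eq_of_heq (Sigma.mk.inj h2).2)
    · omega⟩

variable {H : ∀ i, SimpleGraph (V i)} {a : ℕ} {ℓ : ∀ i, Fin a → V i}

theorem chainGraph_adj_same {i : Fin t} {x y : V i} :
    (chainGraph H ℓ).Adj ⟨i, x⟩ ⟨i, y⟩ ↔ (H i).Adj x y := by
  constructor
  · rintro (⟨j, u, v, h1, h2, h⟩ | ⟨h, -⟩)
    · obtain rfl : i = j := congrArg Sigma.fst h1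
      rwa [eq_of_heq (Sigma.mk.inj h1).2, eq_of_heq (Sigma.mk.inj h2).2]
    · simp at h
  · exact fun h => .inl ⟨i, x, y, rfl, rfl, h⟩

theorem chainGraph_adj_of_ne {i j : Fin t} (hij : i ≠ j) {x : V i} {y : V j} :
    (chainGraph H ℓ).Adj ⟨i, x⟩ ⟨j, y⟩ ↔
      ((i : ℕ) + 1 = j ∨ (j : ℕ) + 1 = i) ∧ ∃ k, ℓ i k = x ∧ ℓ j k = y := by
  constructor
  · rintro (⟨m, u, v, h1, h2, h⟩ | h)
    · exact (hij ((congrArg Sigma.fst h1).trans (congrArg Sigma.fst h2).symm)).elim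
    · exact h
  · exact fun h => .inr h

theorem chainGraph_comap (i : Fin t) : (chainGraph H ℓ).comap (Sigma.mk i) = H i := by
  ext x y
  exact chainGraph_adj_same

theorem map_mem_chainGraph {i : Fin t} {e : Sym2 (V i)} :
    Sym2.map (Sigma.mk i) e ∈ (chainGraph H ℓ).edgeSet ↔ e ∈ (H i).edgeSet := by
  induction e with | _ x y
  exact chainGraph_adj_same

theorem adapterEdge_mem_chainGraph {i j : Fin t} (hij : (i : ℕ) + 1 = j) (k : Fin a) :
    adapterEdge ℓ i j k ∈ (chainGraph H ℓ).edgeSet :=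
  Or.inr ⟨.inl hij, k, rfl, rfl⟩

theorem mem_chainGraph_edgeSet {e : Sym2 (Σ i, V i)} (he : e ∈ (chainGraph H ℓ).edgeSet) :
    (∃ i, ∃ e' ∈ (H i).edgeSet, e = Sym2.map (Sigma.mk i) e') ∨
      ∃ (i j : Fin t) (k : Fin a), (i : ℕ) + 1 = j ∧ e = adapterEdge ℓ i j k := by
  induction e with | _ x y
  rcases he with ⟨i, u, v, rfl, rfl, h⟩ | ⟨h | h, k, h1, h2⟩
  · exact .inl ⟨i, s(u, v), h, rfl⟩
  · refine .inr ⟨x.1, y.1, k, h, ?_⟩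
    rw [adapterEdge, h1, h2]
  · refine .inr ⟨y.1, x.1, k, h, ?_⟩
    rw [adapterEdge, h1, h2]
    exact Sym2.eq_swap

theorem chainGraph_reachable {i : Fin t} {x y : V i} (h : (H i).Reachable x y) :
    (chainGraph H ℓ).Reachable ⟨i, x⟩ ⟨i, y⟩ :=
  h.map (⟨Sigma.mk i, fun h => chainGraph_adj_same.2 h⟩ : H i →g chainGraph H ℓ)

theorem chainGraph_connected (ht : 0 < t) (ha : 0 < a) (hH : ∀ i, (H i).Connected) :
    (chainGraph H ℓ).Connected := by
  have i₀ : Fin t := ⟨0, ht⟩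
  have k₀ : Fin a := ⟨0, ha⟩
  have h1 : ∀ i, (chainGraph H ℓ).Reachable ⟨i₀, ℓ i₀ k₀⟩ ⟨i, ℓ i k₀⟩ := fun i =>
    (Fin.iff_of_consecutive (R := fun i => (chainGraph H ℓ).Reachable ⟨i₀, ℓ i₀ k₀⟩ ⟨i, ℓ i k₀⟩)
      (fun i j hij => by
        have hadj : (chainGraph H ℓ).Adj ⟨i, ℓ i k₀⟩ ⟨j, ℓ j k₀⟩ :=
          .inr ⟨.inl hij, k₀, rfl, rfl⟩
        exact ⟨fun h => h.trans hadj.reachable, fun h => h.trans hadj.symm.reachable⟩) i₀ i).1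
      (SimpleGraph.Reachable.refl _)
  have h2 : ∀ x, (chainGraph H ℓ).Reachable ⟨i₀, ℓ i₀ k₀⟩ x := fun ⟨i, x⟩ =>
    (h1 i).trans (chainGraph_reachable ((hH i).preconnected _ _))
  have : Nonempty (Σ i, V i) := ⟨⟨i₀, ℓ i₀ k₀⟩⟩
  exact ⟨fun x y => (h2 x).symm.trans (h2 y)⟩

section

variable [DecidableEq (Σ i, V i)]

/-- The image of an edge set of one of the graphs in the chain. -/
def chainImage (i : Fin t) (c : Finset (Sym2 (V i))) : Finset (Sym2 (Σ i, V i)) :=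
  c.image (Sym2.map (Sigma.mk i))

theorem sum_chainImage {M : Type*} [AddCommMonoid M] (i : Fin t) (c : Finset (Sym2 (V i)))
    (f : Sym2 (Σ i, V i) → M) :
    ∑ e ∈ chainImage i c, f e = ∑ e ∈ c, f (Sym2.map (Sigma.mk i) e) :=
  Finset.sum_image fun _ _ _ _ h => Sym2.map_sigmaMk_eq_iff.1 h

theorem map_mem_chainImage {i : Fin t} {c : Finset (Sym2 (V i))} {e : Sym2 (V i)} :
    Sym2.map (Sigma.mk i) e ∈ chainImage i c ↔ e ∈ c := by
  simp only [chainImage, Finset.mem_image, Sym2.map_sigmaMk_eq_iff, exists_eq_right]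

theorem disjoint_chainImage {i j : Fin t} (hij : i ≠ j) (c : Finset (Sym2 (V i)))
    (c' : Finset (Sym2 (V j))) : Disjoint (chainImage i c) (chainImage j c') := by
  rw [Finset.disjoint_left]
  intro e he he'
  obtain ⟨x, -, rfl⟩ := Finset.mem_image.1 he
  obtain ⟨y, -, hy⟩ := Finset.mem_image.1 he'
  exact hij (congrArg Sigma.fst (Sym2.map_sigmaMk_inj hy)).symm

theorem adapterEdge_notMem_chainImage {i j m : Fin t} (hij : i ≠ j) (k : Fin a)
    (c : Finset (Sym2 (V m))) : adapterEdge ℓ i j k ∉ chainImage m c := by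
  intro h
  obtain ⟨e, -, he⟩ := Finset.mem_image.1 h
  exact adapterEdge_ne_map ℓ hij k e he.symm

/-- The cycle formed by two cyclically consecutive adapter edges and the edge sets that connect
their end points in the two graphs. -/
def adapterCycle (ℓ : ∀ i, Fin a → V i) (T : ∀ i, Fin a → Finset (Sym2 (V i))) (i j : Fin t)
    (k : Fin a) : Finset (Sym2 (Σ i, V i)) :=
  {adapterEdge ℓ i j k, adapterEdge ℓ i j (finRotate a k)} ∪
    (chainImage i (T i k) ∪ chainImage j (T j k))

theorem sum_adapterCycle {M : Type*} [AddCommMonoid M] (hℓ : ∀ i, Function.Injective (ℓ i))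
    (T : ∀ i, Fin a → Finset (Sym2 (V i))) {i j : Fin t} (hij : (i : ℕ) + 1 = j) {k : Fin a}
    (hk : finRotate a k ≠ k) (f : Sym2 (Σ i, V i) → M) :
    ∑ e ∈ adapterCycle ℓ T i j k, f e =
      (f (adapterEdge ℓ i j k) + f (adapterEdge ℓ i j (finRotate a k))) +
      (∑ e ∈ T i k, f (Sym2.map (Sigma.mk i) e) + ∑ e ∈ T j k, f (Sym2.map (Sigma.mk j) e)) := by
  have hne : i ≠ j := fun h => by subst h; omega
  rw [adapterCycle, Finset.sum_union, Finset.sum_union (disjoint_chainImage hne _ _),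
    sum_chainImage, sum_chainImage, Finset.sum_pair]
  · exact fun h => hk (adapterEdge_inj hℓ hij hij h).2.2.symm
  · simp [Finset.disjoint_left, adapterEdge_notMem_chainImage hne]

/-- The cycle basis of a chain. -/
def chainCycles (ℓ : ∀ i, Fin a → V i) (T : ∀ i, Fin a → Finset (Sym2 (V i)))
    (C : ∀ i, Finset (Finset (Sym2 (V i)))) : Finset (Finset (Sym2 (Σ i, V i))) :=
  (Finset.univ.biUnion fun i => (C i).image (chainImage i)) ∪
    -- Rotation has a fixed point only for `a = 1`. Then the two adapter edges coincide and the set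
    -- would not be even, so this case is left out.
    (Finset.univ.filter fun m : Fin t × Fin t × Fin a =>
      (m.1 : ℕ) + 1 = m.2.1 ∧ finRotate a m.2.2 ≠ m.2.2).image
        fun m => adapterCycle ℓ T m.1 m.2.1 m.2.2

theorem mem_chainCycles {T : ∀ i, Fin a → Finset (Sym2 (V i))}
    {C : ∀ i, Finset (Finset (Sym2 (V i)))} {c : Finset (Sym2 (Σ i, V i))} :
    c ∈ chainCycles ℓ T C ↔ (∃ i, ∃ c' ∈ C i, chainImage i c' = c) ∨
      ∃ (i j : Fin t) (k : Fin a), ((i : ℕ) + 1 = j ∧ finRotate a k ≠ k) ∧ adapterCycle ℓ T i j k = c := by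
  simp only [chainCycles, Finset.mem_union, Finset.mem_biUnion, Finset.mem_univ, true_and,
    Finset.mem_image, Finset.mem_filter, Prod.exists]

/-- The 8 counts two adapter edges and two hops of at most three edges. -/
theorem chainCycles_length_le {T : ∀ i, Fin a → Finset (Sym2 (V i))}
    {C : ∀ i, Finset (Finset (Sym2 (V i)))} {m : ℕ} (hT : ∀ i k, (T i k).card ≤ 3)
    (hC : ∀ i, ∀ c ∈ C i, c.card ≤ m) : ∀ c ∈ chainCycles ℓ T C, c.card ≤ m + 8 := by
  intro c hc
  rcases mem_chainCycles.1 hc with ⟨i, c', hc', rfl⟩ | ⟨i, j, k, -, rfl⟩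
  · have h1 : (chainImage i c').card ≤ c'.card := Finset.card_image_le
    have h2 := hC i c' hc'
    omega
  · have h1 : (chainImage i (T i k)).card ≤ (T i k).card := Finset.card_image_le
    have h2 : (chainImage j (T j k)).card ≤ (T j k).card := Finset.card_image_le
    have h3 := hT i k
    have h4 := hT j k
    have h5 := Finset.card_union_le (chainImage i (T i k)) (chainImage j (T j k))
    have h6 : ({adapterEdge ℓ i j k, adapterEdge ℓ i j (finRotate a k)} :
      Finset (Sym2 (Σ i, V i))).card ≤ 2 := Finset.card_le_two
    have h7 := Finset.card_union_le ({adapterEdge ℓ i j k, adapterEdge ℓ i j (finRotate a k)} :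
      Finset (Sym2 (Σ i, V i))) (chainImage i (T i k) ∪ chainImage j (T j k))
    have h8 : (adapterCycle ℓ T i j k).card ≤ _ := h7
    omega

-- Besides old cycles, an edge lies in at most 6 adapter cycles: two through hops on the left, two
-- through hops on the right, and one for each of the two positions of an adapter edge.
open Classical in
theorem chainCycles_overlap_le (hℓ : ∀ i, Function.Injective (ℓ i))
    {T : ∀ i, Fin a → Finset (Sym2 (V i))} {C : ∀ i, Finset (Finset (Sym2 (V i)))} {m : ℕ}
    (hT : ∀ i e, (Finset.univ.filter fun k => e ∈ T i k).card ≤ 2)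
    (hC : ∀ i e, ((C i).filter fun c => e ∈ c).card ≤ m) (e : Sym2 (Σ i, V i))
    {_ : DecidablePred fun c : Finset (Sym2 (Σ i, V i)) => e ∈ c} :
    ((chainCycles ℓ T C).filter fun c => e ∈ c).card ≤ m + 6 := by
  let I : Finset (Fin t × Fin t × Fin a) := Finset.univ.filter fun x =>
    (x.1 : ℕ) + 1 = x.2.1 ∧ finRotate a x.2.2 ≠ x.2.2
  have hI : ∀ {x}, x ∈ I → (x.1 : ℕ) + 1 = x.2.1 := fun hx => (Finset.mem_filter.1 hx).2.1
  have hold : ((Finset.univ.biUnion fun i => (C i).image (chainImage i)).filter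
      fun c => e ∈ c).card ≤ m := by
    by_cases he : ∃ i e', e = Sym2.map (Sigma.mk i) e'
    · obtain ⟨i, e, rfl⟩ := he
      refine le_trans (Finset.card_le_card
        (t := ((C i).filter fun c => e ∈ c).image (chainImage i)) fun c hc => ?_)
        (Finset.card_image_le.trans (hC i e))
      simp only [Finset.mem_filter, Finset.mem_biUnion, Finset.mem_univ, true_and,
        Finset.mem_image] at hc
      obtain ⟨⟨j, c', hc', rfl⟩, he⟩ := hc
      obtain rfl : j = i := by
        obtain ⟨e', -, he'⟩ := Finset.mem_image.1 he
        exact congrArg Sigma.fst (Sym2.map_sigmaMk_inj he')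
      exact Finset.mem_image_of_mem _ (Finset.mem_filter.2 ⟨hc', map_mem_chainImage.1 he⟩)
    · rw [Finset.filter_false_of_mem, Finset.card_empty]
      · exact Nat.zero_le _
      · intro c hc hec
        simp only [Finset.mem_biUnion, Finset.mem_univ, true_and, Finset.mem_image] at hc
        obtain ⟨j, c', hc', rfl⟩ := hc
        obtain ⟨e', -, he'⟩ := Finset.mem_image.1 hec
        exact he ⟨j, e', he'.symm⟩
  -- `π` selects the left or the right graph of an adapter. The edge fixes this graph, hence the
  -- adapter, and the sparsity of `T` bounds the choices of `k`.
  have hblock : ∀ π : Fin t × Fin t × Fin a → Fin t,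
      (∀ x ∈ I, ∀ y ∈ I, π x = π y → x.2.2 = y.2.2 → x = y) →
      (I.filter fun x => e ∈ chainImage (π x) (T (π x) x.2.2)).card ≤ 2 := by
    intro π hπ
    rcases Finset.eq_empty_or_nonempty
      (I.filter fun x => e ∈ chainImage (π x) (T (π x) x.2.2)) with h | ⟨x₀, hx₀⟩
    · rw [h]
      simp
    · obtain ⟨e', -, rfl⟩ := Finset.mem_image.1 (Finset.mem_filter.1 hx₀).2
      have hfst : ∀ x, Sym2.map (Sigma.mk (π x₀)) e' ∈ chainImage (π x) (T (π x) x.2.2) →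
          π x = π x₀ := fun x hx => by
        obtain ⟨e'', -, h⟩ := Finset.mem_image.1 hx
        exact congrArg Sigma.fst (Sym2.map_sigmaMk_inj h)
      refine le_trans (Finset.card_le_card_of_injOn (fun x => x.2.2) ?_ ?_) (hT (π x₀) e')
      · intro x hx
        have hx := (Finset.mem_filter.1 (Finset.mem_coe.1 hx)).2
        rw [hfst x hx, map_mem_chainImage] at hx
        simpa using hx
      · intro x hx y hy hxy
        have hx := Finset.mem_filter.1 (Finset.mem_coe.1 hx)
        have hy := Finset.mem_filter.1 (Finset.mem_coe.1 hy)
        exact hπ x hx.1 y hy.1 ((hfst x hx.2).trans (hfst y hy.2).symm) hxy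
  have h1 := hblock (fun x => x.1) fun x hx y hy h h' =>
    Prod.ext h (Prod.ext (Fin.ext (by rw [← hI hx, ← hI hy, h])) h')
  have h2 := hblock (fun x => x.2.1) fun x hx y hy h h' =>
    Prod.ext (Fin.ext (by have := hI hx; have := hI hy; rw [h] at *; omega)) (Prod.ext h h')
  have hedge : ∀ ρ : Fin a → Fin a, Function.Injective ρ →
      (I.filter fun x => e = adapterEdge ℓ x.1 x.2.1 (ρ x.2.2)).card ≤ 1 := by
    intro ρ hρ
    rw [Finset.card_le_one]
    intro x hx y hy
    have hx := Finset.mem_filter.1 hx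
    have hy := Finset.mem_filter.1 hy
    obtain ⟨h1, h2, h3⟩ := adapterEdge_inj hℓ (hI hx.1) (hI hy.1) (hx.2.symm.trans hy.2)
    exact Prod.ext h1 (Prod.ext h2 (hρ h3))
  have h3 := hedge id Function.injective_id
  have h4 := hedge (finRotate a) (finRotate a).injective
  have hnew : ((I.image fun x => adapterCycle ℓ T x.1 x.2.1 x.2.2).filter
      fun c => e ∈ c).card ≤ 6 := by
    rw [Finset.filter_image]
    refine Finset.card_image_le.trans ?_
    have h5 := Finset.card_union_le
      (I.filter fun x => e = adapterEdge ℓ x.1 x.2.1 (id x.2.2))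
      (I.filter fun x => e = adapterEdge ℓ x.1 x.2.1 (finRotate a x.2.2))
    have h6 := Finset.card_union_le
      (I.filter fun x => e ∈ chainImage x.1 (T x.1 x.2.2))
      (I.filter fun x => e ∈ chainImage x.2.1 (T x.2.1 x.2.2))
    refine le_trans (Finset.card_le_card fun x hx => ?_) ((Finset.card_union_le _ _).trans
      (Nat.add_le_add (h5.trans (Nat.add_le_add h3 h4)) (h6.trans (Nat.add_le_add h1 h2))))
    obtain ⟨hxI, hxe⟩ := Finset.mem_filter.1 hx
    rw [adapterCycle, Finset.mem_union, Finset.mem_union, Finset.mem_insert,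
      Finset.mem_singleton] at hxe
    simp only [Finset.mem_union, Finset.mem_filter, hxI, true_and, id]
    exact hxe
  rw [chainCycles, Finset.filter_union]
  exact (Finset.card_union_le _ _).trans (Nat.add_le_add hold hnew)

end

variable [∀ i, Fintype (V i)]

-- By injectivity of `ℓ`, a vertex gains at most one adapter edge on each side.
open Classical in
theorem chainGraph_degree_le (hℓ : ∀ i, Function.Injective (ℓ i)) {D : ℕ}
    (hD : ∀ i x, (Finset.univ.filter fun y => (H i).Adj x y).card ≤ D) (x : Σ i, V i)
    {_ : DecidablePred fun y => (chainGraph H ℓ).Adj x y} :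
    (Finset.univ.filter fun y => (chainGraph H ℓ).Adj x y).card ≤ D + 2 := by
  obtain ⟨i, x⟩ := x
  let N : Finset (Σ i, V i) := (Finset.univ.filter fun y => (H i).Adj x y).image (Sigma.mk i)
  let P : (Fin t → Prop) → Finset (Σ i, V i) := fun p =>
    Finset.univ.filter fun y => p y.1 ∧ ∃ k, ℓ i k = x ∧ ℓ y.1 k = y.2
  have hP : ∀ p : Fin t → Prop, (∀ j j', p j → p j' → j = j') → (P p).card ≤ 1 := by
    intro p hp
    rw [Finset.card_le_one]
    intro y hy y' hy'
    obtain ⟨-, hpy, k, h1, h2⟩ := Finset.mem_filter.1 hy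
    obtain ⟨-, hpy', k', h1', h2'⟩ := Finset.mem_filter.1 hy'
    obtain ⟨j, y⟩ := y
    obtain ⟨j', y'⟩ := y'
    have hj : j = j' := hp _ _ hpy hpy'
    subst hj
    have hk : k = k' := hℓ i (h1.trans h1'.symm)
    subst hk
    exact congrArg (Sigma.mk j) (h2.symm.trans h2')
  have h1 := hP (fun j => (i : ℕ) + 1 = j) fun j j' h h' => Fin.ext (by omega)
  have h2 := hP (fun j => (j : ℕ) + 1 = i) fun j j' h h' => Fin.ext (by omega)
  have h3 : N.card ≤ D := Finset.card_image_le.trans (hD i x)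
  refine le_trans (Finset.card_le_card (t := N ∪ (P (fun j => (i : ℕ) + 1 = j) ∪
    P fun j => (j : ℕ) + 1 = i)) fun y hy => ?_) ?_
  · obtain ⟨j, y⟩ := y
    have hy : (chainGraph H ℓ).Adj ⟨i, x⟩ ⟨j, y⟩ := by simpa using hy
    by_cases hij : i = j
    · subst hij
      refine Finset.mem_union_left _ (Finset.mem_image_of_mem _ ?_)
      simpa using chainGraph_adj_same.1 hy
    · refine Finset.mem_union_right _ ?_
      obtain ⟨h | h, k, hk⟩ := (chainGraph_adj_of_ne hij).1 hy
      · exact Finset.mem_union_left _ (by simpa [P, h] using ⟨k, hk⟩)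
      · exact Finset.mem_union_right _ (by simpa [P, h] using ⟨k, hk⟩)
  · have h4 := Finset.card_union_le N (P (fun j => (i : ℕ) + 1 = j) ∪ P fun j => (j : ℕ) + 1 = i)
    have h5 := Finset.card_union_le (P (fun j => (i : ℕ) + 1 = j)) (P fun j => (j : ℕ) + 1 = i)
    omega

theorem coboundary_map (w : (Σ i, V i) → ZMod 2) {i : Fin t} {e : Sym2 (V i)}
    (he : e ∈ (H i).edgeSet) :
    coboundary w (Sym2.map (Sigma.mk i) e) = coboundary (fun x => w ⟨i, x⟩) e := by
  induction e with | _ x y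
  have hne : x ≠ y := SimpleGraph.Adj.ne he
  rw [Sym2.map_mk, coboundary_mk _ hne, coboundary_mk]
  exact fun h => hne (sigma_mk_injective h)

theorem coboundary_adapterEdge (w : (Σ i, V i) → ZMod 2) {i j : Fin t} (hij : i ≠ j) (k : Fin a) :
    coboundary w (adapterEdge ℓ i j k) = w ⟨i, ℓ i k⟩ + w ⟨j, ℓ j k⟩ :=
  coboundary_mk w fun h => hij (congrArg Sigma.fst h)

/-- By duality it suffices to find a potential for every edge vector orthogonal to all cycles. The
pieces have potentials, and the adapter cycles force the mismatch to be constant across each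
adapter. The pieces form a row, not a ring, so these constants can be absorbed one after the other.
-/
theorem chainCycles_isCycleBasis [DecidableEq (Σ i, V i)] (ha : 0 < a) (hℓ : ∀ i, Function.Injective (ℓ i))
    {T : ∀ i, Fin a → Finset (Sym2 (V i))} {C : ∀ i, Finset (Finset (Sym2 (V i)))}
    (hT : ∀ i k, ∀ e ∈ T i k, e ∈ (H i).edgeSet)
    (hTb : ∀ i k (w : V i → ZMod 2),
      ∑ e ∈ T i k, coboundary w e = w (ℓ i k) + w (ℓ i (finRotate a k)))
    (hC : ∀ i, IsCycleBasis (H i) (C i)) :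
    IsCycleBasis (chainGraph H ℓ) (chainCycles ℓ T C) := by
  have hne : ∀ {i j : Fin t}, (i : ℕ) + 1 = j → i ≠ j := fun hij h => by subst h; omega
  have hTb' : ∀ i k (w : (Σ i, V i) → ZMod 2),
      ∑ e ∈ T i k, coboundary w (Sym2.map (Sigma.mk i) e) =
        w ⟨i, ℓ i k⟩ + w ⟨i, ℓ i (finRotate a k)⟩ := fun i k w => by
    rw [← hTb i k fun x => w ⟨i, x⟩]
    exact Finset.sum_congr rfl fun e he => coboundary_map w (hT i k e he)
  apply isCycleBasis_of_forall_exists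
  · intro c hc e he
    rcases mem_chainCycles.1 hc with ⟨i, c', hc', rfl⟩ | ⟨i, j, k, ⟨hij, -⟩, rfl⟩
    · obtain ⟨e', he', rfl⟩ := Finset.mem_image.1 he
      exact map_mem_chainGraph.2 ((hC i).1 c' hc' e' he')
    · rw [adapterCycle, Finset.mem_union, Finset.mem_union, Finset.mem_insert,
        Finset.mem_singleton] at he
      rcases he with (rfl | rfl) | he | he
      · exact adapterEdge_mem_chainGraph hij k
      · exact adapterEdge_mem_chainGraph hij _
      · obtain ⟨e', he', rfl⟩ := Finset.mem_image.1 he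
        exact map_mem_chainGraph.2 (hT _ _ e' he')
      · obtain ⟨e', he', rfl⟩ := Finset.mem_image.1 he
        exact map_mem_chainGraph.2 (hT _ _ e' he')
  · intro c hc
    refine isEvenEdgeSet_of_sum_coboundary fun w => ?_
    rcases mem_chainCycles.1 hc with ⟨i, c', hc', rfl⟩ | ⟨i, j, k, ⟨hij, hk⟩, rfl⟩
    · rw [sum_chainImage, Finset.sum_congr rfl fun e he =>
        coboundary_map (H := H) w ((hC i).1 c' hc' e he)]
      exact ((hC i).isEvenEdgeSet hc').sum_coboundary _
    · rw [sum_adapterCycle hℓ T hij hk, hTb', hTb', coboundary_adapterEdge w (hne hij),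
        coboundary_adapterEdge w (hne hij)]
      have h2 : (2 : ZMod 2) = 0 := rfl
      linear_combination (w ⟨i, ℓ i k⟩ + w ⟨j, ℓ j k⟩ + w ⟨i, ℓ i (finRotate a k)⟩ +
        w ⟨j, ℓ j (finRotate a k)⟩) * h2
  · intro y hy
    choose w hw using fun i => (hC i).exists_coboundary (fun e => y (Sym2.map (Sigma.mk i) e))
      fun c hc => by
        rw [← sum_chainImage]
        exact hy _ (mem_chainCycles.2 (.inl ⟨i, c, hc, rfl⟩))
    -- The mismatch between `y` and the separate potentials on an adapter edge.
    let g : Fin t → Fin t → Fin a → ZMod 2 := fun i j k =>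
      y (adapterEdge ℓ i j k) + (w i (ℓ i k) + w j (ℓ j k))
    have hg : ∀ {i j : Fin t}, (i : ℕ) + 1 = j → ∀ k k', g i j k = g i j k' := by
      intro i j hij
      refine Fin.eq_of_finRotate fun k => ?_
      by_cases hk : finRotate a k = k
      · rw [hk]
      · have h1 := hy _ (mem_chainCycles.2 (.inr ⟨i, j, k, ⟨hij, hk⟩, rfl⟩))
        rw [sum_adapterCycle hℓ T hij hk, Finset.sum_congr rfl fun e he => hw i e (hT _ _ e he),
          Finset.sum_congr rfl fun e he => hw j e (hT _ _ e he), hTb, hTb] at h1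
        rw [← CharTwo.add_eq_zero, ← h1]
        simp only [g]
        ring
    let k₀ : Fin a := ⟨0, ha⟩
    -- The shift from piece `n` to the next; the default 0 past the end is never used on an edge.
    let κ : ℕ → ZMod 2 := fun n =>
      if h : n + 1 < t then g ⟨n, by omega⟩ ⟨n + 1, h⟩ k₀ else 0
    refine ⟨fun x => w x.1 x.2 + ∑ n ∈ Finset.range x.1, κ n, fun e he => ?_⟩
    rcases mem_chainGraph_edgeSet he with ⟨i, e', he', rfl⟩ | ⟨i, j, k, hij, rfl⟩
    · rw [hw i e' he', coboundary_map _ he']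
      induction e' with | _ x x'
      have hxx : x ≠ x' := SimpleGraph.Adj.ne he'
      rw [coboundary_mk _ hxx, coboundary_mk _ hxx]
      have h2 : (2 : ZMod 2) = 0 := rfl
      linear_combination -(∑ n ∈ Finset.range i, κ n) * h2
    · rw [coboundary_adapterEdge _ (hne hij)]
      have h1 : κ i = g i j k := by
        have hlt : (i : ℕ) + 1 < t := hij ▸ j.2
        have hj : (⟨(i : ℕ) + 1, hlt⟩ : Fin t) = j := Fin.ext hij
        simp only [κ, hlt, dif_pos, hj]
        exact hg hij _ _
      simp only [← hij, Finset.sum_range_succ, h1, g]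
      have h2 : (2 : ZMod 2) = 0 := rfl
      linear_combination -(w i (ℓ i k) + w j (ℓ j k) + ∑ n ∈ Finset.range i, κ n) * h2

end Chain
end

/-! ### Relative expansion of a chain -/

noncomputable section

section Expansion

open Classical in
/-- The edges between a vertex set (given by its indicator vector) and its complement. -/
def cutEdges {V : Type*} [Fintype V] (G : SimpleGraph V) (x : V → ZMod 2) : Finset (Sym2 V) :=
  Finset.univ.filter fun e => e ∈ G.edgeSet ∧ coboundary x e ≠ 0

theorem mem_cutEdges {V : Type*} [Fintype V] {G : SimpleGraph V} {x : V → ZMod 2} {e : Sym2 V} :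
    e ∈ cutEdges G x ↔ e ∈ G.edgeSet ∧ coboundary x e ≠ 0 := by
  simp [cutEdges]

open Classical in
theorem card_mulVec_incidence {V : Type*} [Fintype V] (G : SimpleGraph V) (x : V → ZMod 2) :
    (Finset.univ.filter fun e => (incidence G).mulVec x e ≠ 0).card = (cutEdges G x).card := by
  refine Finset.card_bij (fun e _ => e.1) ?_ ?_ ?_
  · intro e he
    rw [mem_cutEdges, ← mulVec_incidence]
    exact ⟨e.2, by simpa using he⟩
  · exact fun _ _ _ _ h => Subtype.ext h
  · intro e he
    rw [mem_cutEdges] at he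
    exact ⟨⟨e, he.1⟩, by simpa [mulVec_incidence] using he.2, rfl⟩

open Classical in
theorem relExpansionGE_one_iff {V : Type*} [Fintype V] {G : SimpleGraph V} {d : ℕ}
    {U : Finset V} : RelExpansionGE G d U 1 ↔ ∀ x : V → ZMod 2,
      min d (min (U.filter fun y => x y ≠ 0).card (U.filter fun y => x y = 0).card) ≤
        (cutEdges G x).card := by
  refine forall_congr' fun x => ?_
  rw [one_mul, Nat.cast_le, card_mulVec_incidence]

theorem RelExpansionGE.mono {V : Type*} [Fintype V] {G G' : SimpleGraph V} (hG : G ≤ G') {d : ℕ}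
    {U : Finset V} (h : RelExpansionGE G d U 1) : RelExpansionGE G' d U 1 := by
  rw [relExpansionGE_one_iff] at h ⊢
  refine fun x => (h x).trans (Finset.card_le_card fun e he => ?_)
  rw [mem_cutEdges] at he ⊢
  exact ⟨SimpleGraph.edgeSet_mono hG he.1, he.2⟩

variable {t : ℕ} {V : Fin t → Type*} [∀ i, Fintype (V i)] {H : ∀ i, SimpleGraph (V i)} {a : ℕ}
  {ℓ : ∀ i, Fin a → V i}

theorem map_mem_cutEdges_chainGraph {x : (Σ i, V i) → ZMod 2} {i : Fin t} {e : Sym2 (V i)} :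
    Sym2.map (Sigma.mk i) e ∈ cutEdges (chainGraph H ℓ) x ↔
      e ∈ cutEdges (H i) fun v => x ⟨i, v⟩ := by
  rw [mem_cutEdges, mem_cutEdges, map_mem_chainGraph]
  exact and_congr_right fun he => by rw [coboundary_map x he]

theorem sum_card_cutEdges_le (x : (Σ i, V i) → ZMod 2) :
    ∑ i, (cutEdges (H i) fun v => x ⟨i, v⟩).card ≤ (cutEdges (chainGraph H ℓ) x).card := by
  classical
  rw [← Finset.card_sigma]
  refine Finset.card_le_card_of_injOn (fun e => Sym2.map (Sigma.mk e.1) e.2) (fun e he => ?_)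
    fun e _ e' _ h => Sym2.map_sigmaMk_inj h
  simpa [map_mem_cutEdges_chainGraph] using he

-- The cuts inside two neighbouring pieces and the cut adapter edges are disjoint parts of the cut
-- of the chain.
open Classical in
theorem card_cutEdges_adapter_le (hℓ : ∀ i, Function.Injective (ℓ i)) (x : (Σ i, V i) → ZMod 2)
    {i j : Fin t} (hij : (i : ℕ) + 1 = j) :
    (cutEdges (H i) fun v => x ⟨i, v⟩).card + (cutEdges (H j) fun v => x ⟨j, v⟩).card +
      (Finset.univ.filter fun k => x ⟨i, ℓ i k⟩ ≠ x ⟨j, ℓ j k⟩).card ≤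
        (cutEdges (chainGraph H ℓ) x).card := by
  have hne : i ≠ j := fun h => by subst h; omega
  have h1 : (cutEdges (H i) fun v => x ⟨i, v⟩).card =
      (chainImage i (cutEdges (H i) fun v => x ⟨i, v⟩)).card :=
    (Finset.card_image_of_injective _ (Sym2.map.injective sigma_mk_injective)).symm
  have h2 : (cutEdges (H j) fun v => x ⟨j, v⟩).card =
      (chainImage j (cutEdges (H j) fun v => x ⟨j, v⟩)).card :=
    (Finset.card_image_of_injective _ (Sym2.map.injective sigma_mk_injective)).symm
  have h3 : (Finset.univ.filter fun k => x ⟨i, ℓ i k⟩ ≠ x ⟨j, ℓ j k⟩).card =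
      ((Finset.univ.filter fun k => x ⟨i, ℓ i k⟩ ≠ x ⟨j, ℓ j k⟩).image
        (adapterEdge ℓ i j)).card :=
    (Finset.card_image_of_injective _ fun k k' h => (adapterEdge_inj hℓ hij hij h).2.2).symm
  rw [h1, h2, h3, ← Finset.card_union_of_disjoint (disjoint_chainImage hne _ _),
    ← Finset.card_union_of_disjoint]
  · refine Finset.card_le_card fun e he => ?_
    rw [Finset.mem_union, Finset.mem_union] at he
    rcases he with (he | he) | he
    · obtain ⟨e', he', rfl⟩ := Finset.mem_image.1 he
      exact map_mem_cutEdges_chainGraph.2 he'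
    · obtain ⟨e', he', rfl⟩ := Finset.mem_image.1 he
      exact map_mem_cutEdges_chainGraph.2 he'
    · obtain ⟨k, hk, rfl⟩ := Finset.mem_image.1 he
      rw [mem_cutEdges, coboundary_adapterEdge x hne]
      refine ⟨adapterEdge_mem_chainGraph hij k, fun h => ?_⟩
      simp only [Finset.mem_filter, Finset.mem_univ, true_and] at hk
      exact hk (CharTwo.add_eq_zero.1 h)
  · rw [Finset.disjoint_right]
    intro e he
    obtain ⟨k, -, rfl⟩ := Finset.mem_image.1 he
    rw [Finset.mem_union]
    exact fun h => h.elim (adapterEdge_notMem_chainImage hne _ _)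
      (adapterEdge_notMem_chainImage hne _ _)

/-- Relative expansion is inherited by chains. -/
theorem chainGraph_relExpansionGE (hℓ : ∀ i, Function.Injective (ℓ i)) {d : ℕ} (hd : d ≤ a)
    {U : ∀ i, Finset (V i)} (hU : ∀ i k, ℓ i k ∈ U i) (h : ∀ i, RelExpansionGE (H i) d (U i) 1) :
    RelExpansionGE (chainGraph H ℓ) d (Finset.univ.sigma U) 1 := by
  classical
  rw [relExpansionGE_one_iff]
  intro x
  set b : Fin t → ℕ := fun i => (cutEdges (H i) fun v => x ⟨i, v⟩).card with hb
  let on : Fin t → ℕ := fun i => ((U i).filter fun v => x ⟨i, v⟩ ≠ 0).card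
  let off : Fin t → ℕ := fun i => ((U i).filter fun v => x ⟨i, v⟩ = 0).card
  have hcard : ∀ (p : (Σ i, V i) → Prop) {_ : DecidablePred p}, ((Finset.univ.sigma U).filter p).card =
      ∑ i, ((U i).filter fun v => p ⟨i, v⟩).card := fun p _ => by
    rw [← Finset.card_sigma]
    congr 1
    ext ⟨i, v⟩
    simp
  have hsum : ∑ i, b i ≤ (cutEdges (chainGraph H ℓ) x).card := sum_card_cutEdges_le x
  have hmin : ∀ i, min d (min (on i) (off i)) ≤ b i := fun i =>
    relExpansionGE_one_iff.1 (h i) fun v => x ⟨i, v⟩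
  rw [hcard, hcard]
  by_cases hbig : ∃ i, d ≤ b i
  · obtain ⟨i, hi⟩ := hbig
    have := Finset.single_le_sum (f := b) (fun _ _ => Nat.zero_le _) (Finset.mem_univ i)
    omega
  push Not at hbig
  -- With every local cut below `d`, each piece pays for all its port vertices on one of the two
  -- sides. If the same side works everywhere, summation is enough.
  have hsmall : ∀ i, on i ≤ b i ∨ off i ≤ b i := fun i => by
    have := hmin i
    have := hbig i
    omega
  by_cases hon : ∀ i, on i ≤ b i
  · have : ∑ i, on i ≤ ∑ i, b i := Finset.sum_le_sum fun i _ => hon i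
    exact (min_le_right _ _).trans ((min_le_left _ _).trans (this.trans hsum))
  by_cases hoff : ∀ i, off i ≤ b i
  · have : ∑ i, off i ≤ ∑ i, b i := Finset.sum_le_sum fun i _ => hoff i
    exact (min_le_right _ _).trans ((min_le_right _ _).trans (this.trans hsum))
  refine (min_le_left _ _).trans ?_
  -- Otherwise the side that is paid for changes somewhere, hence between two neighbours.
  obtain ⟨i, j, hij, hmix⟩ : ∃ i j : Fin t, (i : ℕ) + 1 = j ∧
      ((on i ≤ b i ∧ off j ≤ b j) ∨ (off i ≤ b i ∧ on j ≤ b j)) := by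
    by_contra! hno
    push Not at hon hoff
    obtain ⟨i₁, hi₁⟩ := hon
    obtain ⟨i₂, hi₂⟩ := hoff
    have key := (Fin.iff_of_consecutive (R := fun i => b i < on i) (fun i j hij => by
      have h1 := hno i j hij
      have h2 := hsmall i
      have h3 := hsmall j
      omega) i₁ i₂).1 hi₁
    have := hsmall i₂
    omega
  have hcut := card_cutEdges_adapter_le (H := H) hℓ x hij
  have hside : ∀ (m : Fin t) (p : ZMod 2 → Prop) [DecidablePred p],
      (Finset.univ.filter fun k => p (x ⟨m, ℓ m k⟩)).card ≤
        ((U m).filter fun v => p (x ⟨m, v⟩)).card := fun m p _ => by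
    refine Finset.card_le_card_of_injOn (ℓ m) (fun k hk => ?_) fun k _ k' _ h => hℓ m h
    have hk : p (x ⟨m, ℓ m k⟩) := by simpa using hk
    simp [hU, hk]
  -- Each of the `a ≥ d` adapter edges is cut or has an end on the minority side of its piece. The
  -- minority sides are bounded by the local cuts, so the total cut is at least `d`.
  have hcover : ∀ (p q : ZMod 2 → Prop) [DecidablePred p] [DecidablePred q], (∀ y z, ¬ p y → ¬ q z → y ≠ z) →
      a ≤ (Finset.univ.filter fun k => p (x ⟨i, ℓ i k⟩)).card +
        (Finset.univ.filter fun k => q (x ⟨j, ℓ j k⟩)).card +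
        (Finset.univ.filter fun k => x ⟨i, ℓ i k⟩ ≠ x ⟨j, ℓ j k⟩).card := fun p q _ _ hpq => by
    calc a = (Finset.univ : Finset (Fin a)).card := by simp
      _ ≤ ((Finset.univ.filter fun k => p (x ⟨i, ℓ i k⟩)) ∪
          (Finset.univ.filter fun k => q (x ⟨j, ℓ j k⟩)) ∪
          (Finset.univ.filter fun k => x ⟨i, ℓ i k⟩ ≠ x ⟨j, ℓ j k⟩)).card := by
        refine Finset.card_le_card fun k _ => ?_
        have := hpq (x ⟨i, ℓ i k⟩) (x ⟨j, ℓ j k⟩)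
        simp only [Finset.mem_union, Finset.mem_filter, Finset.mem_univ, true_and]
        tauto
      _ ≤ _ := (Finset.card_union_le _ _).trans (Nat.add_le_add_right (Finset.card_union_le _ _) _)
  rcases hmix with ⟨h1, h2⟩ | ⟨h1, h2⟩
  · have h3 := hcover (fun y => y ≠ 0) (fun y => y = 0) (by decide)
    have h4 : _ ≤ on i := hside i fun y => y ≠ 0
    have h5 : _ ≤ off j := hside j fun y => y = 0
    simp only [hb] at h1 h2
    omega
  · have h3 := hcover (fun y => y = 0) (fun y => y ≠ 0) (by decide)
    have h4 : _ ≤ off i := hside i fun y => y = 0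
    have h5 : _ ≤ on j := hside j fun y => y ≠ 0
    simp only [hb] at h1 h2
    omega

end Expansion

/-! ### The joint auxiliary graph -/

/-- Allows the pairs of all pieces to be indexed by a sigma type. -/
theorem isPathMatching_of_fintype {V ι : Type*} [Fintype ι] {G : SimpleGraph V} {T : Finset V}
    {μ : Finset (Sym2 V)} (a b : ι → V) (p : ∀ j, G.Walk (a j) (b j)) (hp : ∀ j, (p j).IsPath)
    (hinj : Function.Injective (Sum.elim a b)) (hT : ∀ x, x ∈ T ↔ ∃ j, a j = x ∨ b j = x)
    (hdis : ∀ j j', j ≠ j' → ∀ e, e ∈ (p j).edges → e ∉ (p j').edges)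
    (hμ : ∀ e, e ∈ μ ↔ ∃ j, e ∈ (p j).edges) : IsPathMatching G T μ := by
  let σ := (Fintype.equivFin ι).symm
  refine ⟨Fintype.card ι, a ∘ σ, b ∘ σ, fun j => p (σ j), fun j => hp _, ?_, fun x => ?_,
    fun j j' h => hdis _ _ (σ.injective.ne h), fun e => ?_⟩
  · have : Sum.elim (a ∘ σ) (b ∘ σ) = Sum.elim a b ∘ Sum.map σ σ := by
      ext j; cases j <;> rfl
    rw [this]
    exact hinj.comp (σ.injective.sumMap σ.injective)
  · rw [hT, σ.surjective.exists]
    rfl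
  · rw [hμ, σ.surjective.exists]

theorem IsPathMatching.eq_empty {V : Type*} {G : SimpleGraph V} {μ : Finset (Sym2 V)}
    (h : IsPathMatching G ∅ μ) : μ = ∅ := by
  obtain ⟨k, a, b, p, hp, hinj, hT, hdis, hμ⟩ := h
  refine Finset.eq_empty_of_forall_notMem fun e he => ?_
  obtain ⟨j, -⟩ := (hμ e).1 he
  exact Finset.notMem_empty _ ((hT (a j)).2 ⟨j, .inl rfl⟩)

theorem IsPathMatching.sigma {t : ℕ} {V : Fin t → Type*} {_ : DecidableEq (Sym2 (Σ i, V i))}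
    {H : ∀ i, SimpleGraph (V i)}
    {G : SimpleGraph (Σ i, V i)} (hG : ∀ i, H i ≤ G.comap (Sigma.mk i)) {T : ∀ i, Finset (V i)}
    {μ : ∀ i, Finset (Sym2 (V i))} (h : ∀ i, IsPathMatching (H i) (T i) (μ i)) :
    IsPathMatching G (Finset.univ.sigma T)
      (Finset.univ.biUnion fun i => (μ i).image (Sym2.map (Sigma.mk i))) := by
  choose n a b p hp hinj hT hdis hμ using h
  let f : ∀ i, H i →g G := fun i => ⟨Sigma.mk i, fun h => hG i h⟩
  refine isPathMatching_of_fintype (ι := Σ i, Fin (n i)) (fun j => ⟨j.1, a j.1 j.2⟩)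
    (fun j => ⟨j.1, b j.1 j.2⟩) (fun j => (p j.1 j.2).map (f j.1)) (fun j => ?_) ?_ ?_ ?_ ?_
  · exact (hp j.1 j.2).map sigma_mk_injective
  · have aux : ∀ (c c' : ∀ i, Fin (n i) → V i) (i i' : Fin t) (j : Fin (n i)) (j' : Fin (n i')),
        (∀ i j j', c i j = c' i j' → j = j') →
        (⟨i, c i j⟩ : Σ i, V i) = ⟨i', c' i' j'⟩ → (⟨i, j⟩ : Σ i, Fin (n i)) = ⟨i', j'⟩ := by
      intro c c' i i' j j' hc h
      obtain rfl : i = i' := congrArg Sigma.fst h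
      rw [hc i j j' (eq_of_heq (Sigma.mk.inj h).2)]
    have hab : ∀ (i i' : Fin t) (j : Fin (n i)) (j' : Fin (n i')),
        (⟨i, a i j⟩ : Σ i, V i) ≠ ⟨i', b i' j'⟩ := by
      intro i i' j j' h
      obtain rfl : i = i' := congrArg Sigma.fst h
      have := hinj i (a₁ := .inl j) (a₂ := .inr j') (eq_of_heq (Sigma.mk.inj h).2)
      simp at this
    rintro (⟨i, j⟩ | ⟨i, j⟩) (⟨i', j'⟩ | ⟨i', j'⟩) h
    · exact congrArg Sum.inl (aux a a i i' j j' (fun i j j' h => by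
        simpa using hinj i (a₁ := .inl j) (a₂ := .inl j') h) h)
    · exact (hab _ _ _ _ h).elim
    · exact (hab _ _ _ _ h.symm).elim
    · exact congrArg Sum.inr (aux b b i i' j j' (fun i j j' h => by
        simpa using hinj i (a₁ := .inr j) (a₂ := .inr j') h) h)
  · rintro ⟨i, x⟩
    simp only [Finset.mem_sigma, Finset.mem_univ, true_and, hT]
    constructor
    · rintro ⟨j, rfl | rfl⟩
      · exact ⟨⟨i, j⟩, .inl rfl⟩
      · exact ⟨⟨i, j⟩, .inr rfl⟩
    · rintro ⟨⟨i', j⟩, h | h⟩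
      · obtain rfl : i' = i := congrArg Sigma.fst h
        exact ⟨j, .inl (eq_of_heq (Sigma.mk.inj h).2)⟩
      · obtain rfl : i' = i := congrArg Sigma.fst h
        exact ⟨j, .inr (eq_of_heq (Sigma.mk.inj h).2)⟩
  · rintro ⟨i, j⟩ ⟨i', j'⟩ hne e he he'
    simp only [SimpleGraph.Walk.edges_map, List.mem_map] at he he'
    obtain ⟨e₁, he₁, rfl⟩ := he
    obtain ⟨e₂, he₂, h⟩ := he'
    have h := Sym2.map_sigmaMk_inj h
    obtain rfl : i' = i := congrArg Sigma.fst h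
    obtain rfl : e₂ = e₁ := eq_of_heq (Sigma.mk.inj h).2
    exact hdis i' j j' (fun h => hne (h ▸ rfl)) _ he₁ he₂
  · intro e
    simp only [Finset.mem_biUnion, Finset.mem_univ, true_and, Finset.mem_image, hμ,
      SimpleGraph.Walk.edges_map, List.mem_map]
    constructor
    · rintro ⟨i, e', ⟨j, hj⟩, rfl⟩
      exact ⟨⟨i, j⟩, e', hj, rfl⟩
    · rintro ⟨⟨i, j⟩, e', hj, rfl⟩
      exact ⟨i, e', ⟨j, hj⟩, rfl⟩

namespace AuxGraph

variable {Q S : Type*} {t : ℕ} {V : Fin t → Type*}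

theorem joint_portOf (A : ∀ i, AuxGraph Q S (V i)) (G : SimpleGraph (Σ i, V i))
    (C : Finset (Finset (Sym2 (Σ i, V i)))) (R : Finset Q) :
    (joint A G C).portOf R = Finset.univ.sigma fun i => (A i).portOf R := by
  classical
  ext ⟨i, x⟩
  simp [portOf, joint]

theorem sum_le_card_mul {ι : Type*} [Fintype ι] {s : Finset ι} {f : ι → ℕ} {m : ℕ}
    (hs : ∀ i, i ∉ s → f i = 0) (hf : ∀ i, f i ≤ m) : ∑ i, f i ≤ s.card * m := by
  rw [← Finset.sum_subset (Finset.subset_univ s) fun i _ hi => hs i hi, ← smul_eq_mul]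
  exact Finset.sum_le_card_nsmul _ _ _ fun i _ => hf i

open Classical in
theorem joint_port_le {A : ∀ i, AuxGraph Q S (V i)} {G : SimpleGraph (Σ i, V i)}
    {C : Finset (Finset (Sym2 (Σ i, V i)))} {c m : ℕ}
    (hc : ∀ q, (Finset.univ.filter fun i => ((A i).port q).Nonempty).card ≤ c)
    (hm : ∀ i q, ((A i).port q).card ≤ m) (q : Q) : ((joint A G C).port q).card ≤ c * m := by
  have h1 : ((joint A G C).port q).card = ∑ i, ((A i).port q).card := Finset.card_sigma _ _
  rw [h1]
  refine (sum_le_card_mul (s := Finset.univ.filter fun i => ((A i).port q).Nonempty)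
    (fun i hi => ?_) fun i => hm i q).trans (Nat.mul_le_mul_right _ (hc q))
  simpa using hi

-- The matchings of different pieces use different edges, so no factor depending on the number of
-- pieces arises.
open Classical in
theorem joint_matchOverlap_le [Fintype S] {A : ∀ i, AuxGraph Q S (V i)}
    {G : SimpleGraph (Σ i, V i)} {C : Finset (Finset (Sym2 (Σ i, V i)))} {m : ℕ}
    (hm : ∀ i e, (Finset.univ.filter fun s => e ∈ (A i).matching s).card ≤ m)
    (e : Sym2 (Σ i, V i)) {_ : DecidablePred fun s => e ∈ (joint A G C).matching s} :
    (Finset.univ.filter fun s => e ∈ (joint A G C).matching s).card ≤ m := by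
  by_cases he : ∃ i e', e = Sym2.map (Sigma.mk i) e'
  · obtain ⟨i, e, rfl⟩ := he
    refine (Finset.card_le_card fun s hs => ?_).trans (hm i e)
    simp only [joint, Finset.mem_filter, Finset.mem_univ, true_and, Finset.mem_biUnion,
      Finset.mem_image] at hs ⊢
    obtain ⟨j, e', he', h⟩ := hs
    have h := Sym2.map_sigmaMk_inj h
    obtain rfl : j = i := congrArg Sigma.fst h
    obtain rfl : e' = e := eq_of_heq (Sigma.mk.inj h).2
    exact he'
  · rw [Finset.filter_false_of_mem, Finset.card_empty]
    · exact Nat.zero_le _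
    · intro s _ hs
      simp only [joint, Finset.mem_biUnion, Finset.mem_univ, true_and, Finset.mem_image] at hs
      obtain ⟨j, e', -, h⟩ := hs
      exact he ⟨j, e', h.symm⟩

variable [Fintype Q]

-- A check acts on at most `α` qubits, each attached to at most `c` pieces; in every other piece
-- there is nothing to match and its matching is empty.
open Classical in
theorem joint_matching_card_le {A : ∀ i, AuxGraph Q S (V i)} {G : SimpleGraph (Σ i, V i)}
    {C : Finset (Finset (Sym2 (Σ i, V i)))} {check : S → Pauli Q} {c m α : ℕ}
    (hc : ∀ q, (Finset.univ.filter fun i => ((A i).port q).Nonempty).card ≤ c)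
    (hA : ∀ i s, IsPathMatching (A i).graph ((A i).portOf (check s).xSupport) ((A i).matching s))
    (hα : ∀ s, (check s).weight ≤ α)
    (hm : ∀ i s, ((A i).matching s).card ≤ m) (s : S) :
    ((joint A G C).matching s).card ≤ α * c * m := by
  let F := (check s).xSupport.biUnion fun q => Finset.univ.filter fun i => ((A i).port q).Nonempty
  have hF : F.card ≤ α * c := by
    refine (Finset.card_biUnion_le_card_mul _ _ c fun q _ => hc q).trans
      (Nat.mul_le_mul_right _ ((Finset.card_le_card fun q hq => ?_).trans (hα s)))
    exact Pauli.mem_support.2 (.inl (Pauli.mem_xSupport.1 hq))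
  have h1 : ((joint A G C).matching s).card ≤ ∑ i, ((A i).matching s).card :=
    Finset.card_biUnion_le.trans (Finset.sum_le_sum fun i _ => Finset.card_image_le)
  refine h1.trans ((sum_le_card_mul (s := F) (fun i hi => ?_) fun i => hm i s).trans
    (Nat.mul_le_mul_right _ hF))
  have hempty : (A i).portOf (check s).xSupport = ∅ := by
    refine Finset.eq_empty_of_forall_notMem fun x hx => hi ?_
    obtain ⟨q, hq, hx⟩ := Finset.mem_biUnion.1 hx
    exact Finset.mem_biUnion.2 ⟨q, hq, by simpa using ⟨x, hx⟩⟩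
  have := hA i s
  rw [hempty] at this
  rw [this.eq_empty, Finset.card_empty]

/-- Modulo 2 the port sizes are the Z-components, and both add up over the pieces. -/
theorem joint_port_parity {A : ∀ i, AuxGraph Q S (V i)} {G : SimpleGraph (Σ i, V i)}
    {C : Finset (Finset (Sym2 (Σ i, V i)))} {Z : Fin t → Pauli Q} (hZ : ∀ i, (Z i).IsZType)
    (h : ∀ i q, Odd ((A i).port q).card ↔ q ∈ (Z i).support) (q : Q) :
    Odd ((joint A G C).port q).card ↔ q ∈ (∑ i, Z i).support := by
  have h1 : ((joint A G C).port q).card = ∑ i, ((A i).port q).card := Finset.card_sigma _ _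
  have h2 : ∀ i, (((A i).port q).card : ZMod 2) = (Z i).2 q := fun i => by
    have := congrFun (congrArg Prod.snd (portZ_one_of_parity (hZ i) (h i))) q
    simpa [portZ] using this
  have h3 : (∑ i, Z i).1 q = 0 := by
    rw [Prod.fst_sum, Finset.sum_apply]
    exact Finset.sum_eq_zero fun i _ => congrFun (hZ i) q
  rw [← ZMod.natCast_eq_one_iff_odd, h1, Nat.cast_sum, Finset.sum_congr rfl fun i _ => h2 i,
    Pauli.mem_support, h3, Prod.snd_sum, Finset.sum_apply]
  generalize ∑ i, (Z i).2 q = a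
  revert a
  decide

end AuxGraph
end

/-! ### Assembly of the chain and the main theorem -/

noncomputable section

/-- Guarantees that adapters of size `d` are nonempty, as needed for connectedness and for comparing
potentials across an adapter. -/
theorem one_le_codeDistance {Q S : Type*} [Fintype Q] (check : S → Pauli Q) :
    1 ≤ codeDistance check := by
  refine le_iInf₂ fun P hP => ?_
  rw [Nat.one_le_cast, Nat.one_le_iff_ne_zero]
  intro h
  refine hP.2 ?_
  have h0 : ∀ q, P.1 q = 0 ∧ P.2 q = 0 := fun q => by
    have hq : q ∉ P.support := by rw [Finset.card_eq_zero.1 h]; simp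
    rw [Pauli.mem_support] at hq
    tauto
  rw [show P = 0 from Prod.ext (funext fun q => (h0 q).1) (funext fun q => (h0 q).2)]
  exact Submodule.zero_mem _

/-- The bounds for a chain of auxiliary graphs on an `(α, β)`-LDPC code, if every qubit is attached
to at most `c` of them. -/
def DesiderataBounds.chain (K : DesiderataBounds) (α β c : ℕ) : DesiderataBounds where
  degree := K.degree + β + 2
  portSize := c * K.portSize
  matchSize := α * c * K.matchSize
  matchOverlap := K.matchOverlap
  cycleLength := K.cycleLength + (K.matchSize + 1) + 8
  cycleOverlap := K.cycleOverlap + (K.matchOverlap + β) + 6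

namespace AuxGraph

open Classical in
/-- Auxiliary graphs for `Z`-type logical operators can be chained to an auxiliary graph for the
product. -/
theorem exists_joint {Q S : Type*} [Fintype Q] [Fintype S] {check : S → Pauli Q} {α β c d t : ℕ}
    {K : DesiderataBounds} (hL : IsLDPC check α β) (hd : codeDistance check = d) (ht : 0 < t)
    {Z : Fin t → Pauli Q} (hnt : ∀ i, IsNontrivialLogical check (Z i))
    (hZ : ∀ i, (Z i).IsZType) {V : Fin t → Type*} [∀ i, Fintype (V i)]
    {A : ∀ i, AuxGraph Q S (V i)}
    (hA : ∀ i, (A i).SatisfiesDesiderata check (Z i).support d K)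
    (hc : ∀ q, (Finset.univ.filter fun i => ((A i).port q).Nonempty).card ≤ c) :
    ∃ (G : SimpleGraph (Σ i, V i)) (C : Finset (Finset (Sym2 (Σ i, V i)))),
      IsAdaptedChain A check d G ∧
      (joint A G C).SatisfiesDesiderata check (∑ i, Z i).support d
        (K.chain α β c) := by
  have hd0 : 0 < d := by
    have := one_le_codeDistance check
    rw [hd, Nat.one_le_cast] at this
    exact this
  choose H C ℓ hAH hHA hC hℓ hport hdeg hlen hover using fun i =>
    (hA i).exists_extension (hZ i) hL (hnt i).2 hd.ge hd0
  choose hinj T hTsub hT3 hT2 hTb using hℓ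
  have hTb' : ∀ i k (w : V i → ZMod 2),
      ∑ e ∈ T i k, coboundary w e = w (ℓ i k) + w (ℓ i (finRotate d k)) := by
    intro i k w
    rw [sum_coboundary, Finset.sum_congr rfl fun x _ => by rw [hTb]]
    simp [add_mul, Finset.sum_add_distrib]
  have hsub : ∀ i, (A i).graph ≤ (chainGraph H ℓ).comap (Sigma.mk i) := fun i => by
    rw [chainGraph_comap]
    exact hAH i
  -- Adapters of exactly `d` edges suffice.
  refine ⟨chainGraph H ℓ, chainCycles ℓ T C, ⟨hsub, fun i x y h => ?_, d, ℓ, le_rfl, hport,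
    fun i => ?_, fun i j hij x y => chainGraph_adj_of_ne hij⟩, ?_⟩
  · exact hHA i x y (chainGraph_adj_same.1 h)
  · rw [chainGraph_comap]
    exact ⟨hinj i, T i, hTsub i, hT3 i, hT2 i, hTb i⟩
  · exact
    { port_disjoint := fun q q' h => by
        rw [Finset.disjoint_left]
        rintro ⟨i, x⟩ hx hx'
        exact Finset.disjoint_left.1 ((hA i).port_disjoint q q' h) (Finset.mem_sigma.1 hx).2
          (Finset.mem_sigma.1 hx').2
      port_parity := joint_port_parity hZ fun i => (hA i).port_parity
      isPathMatching := fun s => by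
        rw [joint_portOf]
        exact IsPathMatching.sigma hsub fun i => (hA i).isPathMatching s
      isCycleBasis := chainCycles_isCycleBasis hd0 hinj (fun i k e he => (hTsub i k e he).1) hTb' hC
      connected := chainGraph_connected ht hd0 fun i => (hA i).connected.mono (hAH i)
      degree_le := fun x => chainGraph_degree_le hinj hdeg x
      port_le := joint_port_le hc fun i => (hA i).port_le
      matchSize_le := joint_matching_card_le hc (fun i => (hA i).isPathMatching) hL.1
        fun i => (hA i).matchSize_le
      matchOverlap_le := fun e => joint_matchOverlap_le (fun i => (hA i).matchOverlap_le) e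
      cycleLength_le := chainCycles_length_le hT3 hlen
      cycleOverlap_le := fun e => chainCycles_overlap_le hinj hT2 hover e
      expansion := by
        rw [joint_portOf]
        exact chainGraph_relExpansionGE hinj le_rfl hport fun i => (hA i).expansion.mono (hAH i) }

end AuxGraph
end

open Classical in
theorem theorem4 (α β c : ℕ) (K : DesiderataBounds) :
    ∃ (α' β' : ℕ) (K' : DesiderataBounds),
    ∀ (Q : Type u) [Fintype Q] (S : Type v) [Fintype S]
      -- the original code
      (check : S → Pauli Q) (_ : ChecksCommute check) (_ : IsLDPC check α β)
      (d : ℕ) (_ : codeDistance check = d)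
      -- the logical operators
      (t : ℕ) (_ : 0 < t) (Z : Fin t → Pauli Q)
      (_ : ∀ i, IsNontrivialLogical check (Z i)) (_ : IsCDisjoint c Z)
      -- the local basis in which they are all of Z-type
      (U : LocalClifford Q) (_ : ∀ i, (U.act (Z i)).IsZType)
      -- the given auxiliary graphs
      (V : Fin t → Type w) [∀ i, Fintype (V i)] (A : ∀ i, AuxGraph Q S (V i))
      (_ : ∀ i, (A i).SatisfiesDesiderata (fun s => U.act (check s)) (U.act (Z i)).support d K)
      (_ : ∀ q, (Finset.univ.filter fun i => ((A i).port q).Nonempty).card ≤ c),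
    ∃ (G : SimpleGraph (Σ i, V i)) (C : Finset (Finset (Sym2 (Σ i, V i)))),
      -- the given graphs are chained with adapters
      AuxGraph.IsAdaptedChain A (fun s => U.act (check s)) d G ∧
      -- the desiderata hold for the product of the logical operators
      (AuxGraph.joint A G C).SatisfiesDesiderata (fun s => U.act (check s))
        (∑ i, U.act (Z i)).support d K' ∧
      -- the deformed code is a stabilizer code that measures the product
      ChecksCommute ((AuxGraph.joint A G C).deformed fun s => U.act (check s)) ∧
      ∑ x, (AuxGraph.joint A G C).vertexCheck x =
        (AuxGraph.joint A G C).extend (∑ i, U.act (Z i)) ∧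
      (IsNontrivialLogical check (∑ i, Z i) →
        numLogical ((AuxGraph.joint A G C).deformed fun s => U.act (check s)) =
          numLogical check - 1) ∧
      -- it is LDPC and has distance at least d
      IsLDPC ((AuxGraph.joint A G C).deformed fun s => U.act (check s)) α' β' ∧
      (d : ℕ∞) ≤ codeDistance ((AuxGraph.joint A G C).deformed fun s => U.act (check s)) := by
  let K' := K.chain α β c
  refine ⟨α + K'.matchSize + (K'.degree + 1) + K'.cycleLength,
    β + K'.portSize + K'.matchOverlap + 2 + K'.cycleOverlap, K', ?_⟩
  intro Q _ S _ check hcomm hL d hd t ht Z hnt _ U hZ V _ A hA hc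
  -- Local Cliffords preserve commutation, supports and ranks, so the work is done in the rotated
  -- code, where all operators are Z-type.
  have hcomm' := U.checksCommute_act hcomm
  have hL' := U.isLDPC_act hL
  have hd' : codeDistance (fun s => U.act (check s)) = d := (U.codeDistance_act check).trans hd
  obtain ⟨G, C, hG, hJ⟩ := AuxGraph.exists_joint hL' hd' ht
    (fun i => (U.isNontrivialLogical_act check (Z i)).2 (hnt i)) hZ hA hc
  have hZsum : (∑ i, U.act (Z i)).IsZType := by
    rw [Pauli.IsZType, Prod.fst_sum]
    exact Finset.sum_eq_zero fun i _ => hZ i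
  refine ⟨G, C, hG, hJ, hJ.checksCommute_deformed hcomm', hJ.sum_vertexCheck hZsum, fun h => ?_,
    hJ.isLDPC_deformed hL', hJ.le_codeDistance_deformed hcomm' hd'.ge⟩
  have h' := (U.isNontrivialLogical_act check (∑ i, Z i)).2 h
  rw [U.act_sum] at h'
  rw [hJ.numLogical_deformed hZsum hcomm' h'.2, U.numLogical_act]
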